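/- Let $\mathbb K=\mathbb R$ or $\mathbb C$, $m\in\mathbb N$, $0<p<\infty$, $1<r\le\infty$ and $\frac1r+\frac1{r'}=1$. For a finite sequence $(y_j)_j$ in a normed space $E$ put $w_p((y_j)_j)=\sup\{(\sum_j|\gamma(y_j)|^p)^{1/p}:\gamma\in E',\ \|\gamma\|\le1\}$. For a continuous $m$-linear operator $T:E_1\times\dots\times E_m\to X$ let $\pi_p(T)$ be the infimum of all $C>0$ such that $$\Big(\sum_{j_1,\dots,j_m}\|T(x^1_{j_1},\dots,x^m_{j_m})\|_X^p\Big)^{1/p}\le C\,w_p((x^1_{j_1})_{j_1})\cdots w_p((x^m_{j_m})_{j_m})$$ for all finite sequences $(x^k_{j_k})_{j_k}$ in $E_k$; $T$ is called multiple $p$-summing if such a $C$ exists. A normed space $X$ is an $\mathcal L_q^g$-space ($1\le q\le\infty$) if there is $\lambda\in[1,\infty)$ such that for each finite dimensional subspace $M\subset X$ and each $\varepsilon>0$ the inclusion $M\to X$ factors as $SR$ with linear maps $R:M\to\ell_q^n$, $S:\ell_q^n\to X$, for some $n\in\mathbb N$, and $\|S\|\|R\|\le\lambda+\varepsilon$.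 For $0<s\le2$ let $\mu_s$ be the $s$-stable measure on $\mathbb K$, that is, the probability measure with $\int_{\mathbb K}e^{i\,\mathrm{Re}(\bar w z)}\,d\mu_s(z)=e^{-\sigma|w|^s}$ for all $w\in\mathbb K$, where $\sigma>0$ is a fixed normalization (for $s=2$ this is a Gaussian measure), and let $\mu_s^N$ be its $N$-fold product on $\mathbb K^N$. For $T\in\mathcal L({}^m\ell_r^N;X)$ (the continuous $m$-linear operators $\ell_r^N\times\dots\times\ell_r^N\to X$) put $$I_p(T)=\Big(\int_{\mathbb K^N}\cdots\int_{\mathbb K^N}\|T(z^{(1)},\dots,z^{(m)})\|_X^p\,d\mu_{r'}^N(z^{(1)})\cdots d\mu_{r'}^N(z^{(m)})\Big)^{1/p}.$$ (i) Let $X$ be an $\mathcal L_q^g$-space and suppose that either $r=2$ and $p,q<2$; or $r=2$ and $q\le p$; or $p<r'<2$ and $q\le2$. Then there are constants $c,C>0$, independent of $N$ and $T$, such that for all $N$ every $T\in\mathcal L({}^m\ell_r^N;X)$ is multiple $p$-summing and $$c\,I_p(T)\le\pi_p(T)\le C\,I_p(T).$$ (ii) If $r=2$ or $p<r'<2$,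 then there is a constant $c>0$, independent of $N$, $T$ and $X$, such that for every Banach space $X$ and all $N$ every $T\in\mathcal L({}^m\ell_r^N;X)$ is multiple $p$-summing and $$c\,I_p(T)\le\pi_p(T).$$ -/

import Mathlib

section

open MeasureTheory ProbabilityTheory Filter Topology Set
open scoped ENNReal NNReal

/-! ### Existence of the isotropic stable laws -/

namespace StableLaw


theorem exists_of_tendsto_charFun {E : Type*} [NormedAddCommGroup E] [InnerProductSpace ℝ E]
    [FiniteDimensional ℝ E] [MeasurableSpace E] [BorelSpace E]
    (ν : ℕ → ProbabilityMeasure E) (f : E → ℂ)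
    (hf : ContinuousAt f 0)
    (h : ∀ t, Tendsto (fun n => charFun (ν n : Measure E) t) atTop (𝓝 (f t))) :
    ∃ μ : ProbabilityMeasure E, ∀ t, charFun (μ : Measure E) t = f t := by
  have htight := isTightMeasureSet_of_tendsto_charFun (μ := fun n => (ν n : Measure E)) hf h
  have hc : IsCompact (closure (range ν)) := by
    apply isCompact_closure_of_isTightMeasureSet
    convert! htight using 1
    ext m
    simp
  obtain ⟨μ, -, hμ : Tendsto _ _ _⟩ := hc.ultrafilter_le_nhds ((Ultrafilter.of atTop).map ν)
    (by
      rw [Ultrafilter.coe_map, le_principal_iff]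
      exact mem_of_superset (range_mem_map) subset_closure)
  refine ⟨μ, fun t => ?_⟩
  have hU : ((Ultrafilter.of atTop : Ultrafilter ℕ) : Filter ℕ) ≤ atTop := Ultrafilter.of_le _
  have h1 : Tendsto ν (Ultrafilter.of atTop : Ultrafilter ℕ) (𝓝 μ) := hμ
  rw [ProbabilityMeasure.tendsto_iff_forall_integral_rclike_tendsto ℂ] at h1
  refine tendsto_nhds_unique ?_ ((h t).mono_left hU)
  simp_rw [charFun_eq_integral_innerProbChar]
  exact h1 _

theorem exists_pow_charFun {E : Type*} [NormedAddCommGroup E] [InnerProductSpace ℝ E]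
    [FiniteDimensional ℝ E] [MeasurableSpace E] [BorelSpace E]
    (ν : ProbabilityMeasure E) (n : ℕ) :
    ∃ μ : ProbabilityMeasure E, ∀ t, charFun (μ : Measure E) t = charFun (ν : Measure E) t ^ n := by
  induction n with
  | zero => exact ⟨⟨Measure.dirac 0, inferInstance⟩, fun t => by simp [charFun_dirac]⟩
  | succ n ih =>
    obtain ⟨μ, hμ⟩ := ih
    refine ⟨⟨(μ : Measure E) ∗ (ν : Measure E), inferInstance⟩, fun t => ?_⟩
    simp [charFun_conv, hμ, pow_succ]

theorem exists_smul_charFun {E : Type*} [NormedAddCommGroup E] [InnerProductSpace ℝ E]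
    [MeasurableSpace E] [BorelSpace E]
    (ν : ProbabilityMeasure E) (c : ℝ) :
    ∃ μ : ProbabilityMeasure E, ∀ t, charFun (μ : Measure E) t = charFun (ν : Measure E) (c • t) :=
  ⟨⟨(ν : Measure E).map (c • ·), Measure.isProbabilityMeasure_map (by fun_prop)⟩,
    fun t => by simp [charFun_map_smul]⟩

theorem exists_mixture {E : Type*} [NormedAddCommGroup E] [InnerProductSpace ℝ E]
    [FiniteDimensional ℝ E] [MeasurableSpace E] [BorelSpace E]
    (P : Measure ℝ) [IsProbabilityMeasure P] (hP : ∀ᵐ v ∂P, 0 ≤ v) :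
    ∃ μ : ProbabilityMeasure E, ∀ t,
      charFun (μ : Measure E) t = ((∫ v, Real.exp (-(‖t‖ ^ 2 * v)) ∂P : ℝ) : ℂ) := by
  have hm : Measurable (fun z : ℝ × E => Real.sqrt (2 * z.1) • z.2) := by fun_prop
  refine ⟨⟨(P.prod (stdGaussian E)).map (fun z => Real.sqrt (2 * z.1) • z.2),
    Measure.isProbabilityMeasure_map hm.aemeasurable⟩, fun t => ?_⟩
  rw [ProbabilityMeasure.coe_mk, charFun_apply, integral_map hm.aemeasurable
    (Measurable.aestronglyMeasurable (by fun_prop)), integral_prod]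
  · rw [← integral_complex_ofReal]
    refine integral_congr_ae ?_
    filter_upwards [hP] with v hv
    have := charFun_stdGaussian (E := E) (Real.sqrt (2 * v) • t)
    rw [charFun_apply] at this
    simp only [inner_smul_left, inner_smul_right] at this ⊢
    simp only [conj_trivial] at this ⊢
    rw [this, norm_smul, Real.norm_of_nonneg (Real.sqrt_nonneg _)]
    push_cast
    congr 1
    rw [mul_pow, ← Complex.ofReal_pow, Real.sq_sqrt (by positivity)]
    push_cast
    ring
  · refine (integrable_const (1 : ℝ)).mono' (Measurable.aestronglyMeasurable (by fun_prop)) ?_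
    exact Eventually.of_forall fun z => by simp [Complex.norm_exp_ofReal_mul_I]

theorem laplace_kernel_integrable {α : ℝ} (h0 : 0 < α) (h1 : α < 1) :
    IntegrableOn (fun w : ℝ => α * (1 - Real.exp (-w)) * w ^ (-(α + 1))) (Ioi 0) := by
  have hmeas : Measurable (fun w : ℝ => α * (1 - Real.exp (-w)) * w ^ (-(α + 1))) := by fun_prop
  rw [← Ioc_union_Ioi_eq_Ioi zero_le_one]
  refine IntegrableOn.union ?_ ?_
  · have hi : IntegrableOn (fun w : ℝ => w ^ (-α)) (Ioc 0 1) := by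
      rw [← intervalIntegrable_iff_integrableOn_Ioc_of_le zero_le_one]
      exact intervalIntegral.intervalIntegrable_rpow' (by linarith)
    refine (hi.const_mul α).mono' hmeas.aestronglyMeasurable ?_
    refine (ae_restrict_iff' measurableSet_Ioc).2 (Eventually.of_forall fun w hw => ?_)
    have hw0 : 0 < w := hw.1
    have e1 : 0 ≤ 1 - Real.exp (-w) := by
      have := Real.exp_le_one_iff.2 (neg_nonpos.2 hw0.le); linarith
    have e2 : 1 - Real.exp (-w) ≤ w := by have := Real.add_one_le_exp (-w); linarith
    have e3 : w ^ (-α) = w * w ^ (-(α + 1)) := by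
      rw [← Real.rpow_one_add' hw0.le (by linarith)]; congr 1; ring
    rw [Real.norm_of_nonneg (by positivity), e3, ← mul_assoc]
    gcongr
  · have hi := integrableOn_Ioi_rpow_of_lt (a := -(α + 1)) (by linarith) zero_lt_one
    refine (hi.const_mul α).mono' hmeas.aestronglyMeasurable ?_
    refine (ae_restrict_iff' measurableSet_Ioi).2 (Eventually.of_forall fun w hw => ?_)
    have hw0 : 0 < w := zero_lt_one.trans hw
    have e1 : 0 ≤ 1 - Real.exp (-w) := by
      have := Real.exp_le_one_iff.2 (neg_nonpos.2 hw0.le); linarith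
    have e2 : 1 - Real.exp (-w) ≤ 1 := by have := Real.exp_pos (-w); linarith
    rw [Real.norm_of_nonneg (by positivity)]
    gcongr
    nlinarith

theorem one_sub_laplace_pareto {α : ℝ} (h0 : 0 < α) {u : ℝ} (hu : 0 < u) :
    1 - ∫ v, Real.exp (-(u * v)) ∂(paretoMeasure 1 α)
      = u ^ α * ∫ w in Ioi u, α * (1 - Real.exp (-w)) * w ^ (-(α + 1)) := by
  have := isProbabilityMeasure_paretoMeasure (t := 1) (r := α) one_pos h0
  have hae : ∀ᵐ v ∂(paretoMeasure 1 α), 0 ≤ v := by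
    rw [paretoMeasure, ae_withDensity_iff (by unfold paretoPDF; fun_prop)]
    refine Eventually.of_forall fun v hv => ?_
    by_contra hneg
    exact hv (paretoPDF_of_lt (by linarith))
  have hint : Integrable (fun v => Real.exp (-(u * v))) (paretoMeasure 1 α) := by
    refine (integrable_const (1 : ℝ)).mono' (Measurable.aestronglyMeasurable (by fun_prop)) ?_
    filter_upwards [hae] with v hv
    rw [Real.norm_of_nonneg (Real.exp_nonneg _), Real.exp_le_one_iff]
    nlinarith
  have e1 : 1 - ∫ v, Real.exp (-(u * v)) ∂(paretoMeasure 1 α)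
      = ∫ v, (1 - Real.exp (-(u * v))) ∂(paretoMeasure 1 α) := by
    rw [integral_sub (integrable_const _) hint]; simp
  have hs := integral_comp_mul_left_Ioi
    (fun w : ℝ => α * (1 - Real.exp (-w)) * w ^ (-(α + 1))) 1 hu
  rw [mul_one] at hs
  have hs' : ∫ w in Ioi u, α * (1 - Real.exp (-w)) * w ^ (-(α + 1))
      = u * ∫ v in Ioi (1 : ℝ), α * (1 - Real.exp (-(u * v))) * (u * v) ^ (-(α + 1)) := by
    rw [hs, smul_eq_mul, ← mul_assoc, mul_inv_cancel₀ hu.ne', one_mul]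
  have hpm : Measurable (paretoPDF 1 α) := by unfold paretoPDF; fun_prop
  rw [e1, hs', paretoMeasure, integral_withDensity_eq_integral_toReal_smul hpm
    (Eventually.of_forall fun _ => ENNReal.ofReal_lt_top)]
  rw [← integral_const_mul, ← integral_const_mul, ← integral_Ici_eq_integral_Ioi,
    ← integral_indicator measurableSet_Ici]
  refine integral_congr_ae (Eventually.of_forall fun v => ?_)
  by_cases hv : 1 ≤ v
  · have hv0 : 0 < v := by linarith
    have e : u ^ (-(α + 1)) * u ^ α * u = 1 := by
      rw [← Real.rpow_add hu, ← Real.rpow_add_one hu.ne']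
      ring_nf
      simp
    simp only [indicator_of_mem (mem_Ici.2 hv), paretoPDF_of_le hv, smul_eq_mul]
    rw [ENNReal.toReal_ofReal (by positivity), Real.one_rpow, Real.mul_rpow hu.le hv0.le]
    linear_combination (-(α * (1 - Real.exp (-(u * v))) * v ^ (-(α + 1)))) * e
  · simp [indicator, hv, paretoPDF_of_lt (not_le.1 hv)]

theorem exists_laplace {α : ℝ} (h0 : 0 < α) (h1 : α < 1) :
    ∃ K : ℝ, 0 < K ∧ ∀ x : ℝ, 0 ≤ x → Tendsto (fun n : ℕ =>
      (∫ v, Real.exp (-(x * (n : ℝ) ^ (-α⁻¹) * v)) ∂(paretoMeasure 1 α)) ^ n) atTop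
      (𝓝 (Real.exp (-(K * x ^ α)))) := by
  have := isProbabilityMeasure_paretoMeasure (t := 1) (r := α) one_pos h0
  set h : ℝ → ℝ := fun w => α * (1 - Real.exp (-w)) * w ^ (-(α + 1)) with hh
  have hi : IntegrableOn h (Ioi 0) := laplace_kernel_integrable h0 h1
  have hpos : ∀ w ∈ Ioi (0 : ℝ), 0 < h w := fun w (hw : 0 < w) => by
    have : 0 < 1 - Real.exp (-w) := by
      have : Real.exp (-w) < 1 := by simpa using hw
      linarith
    simp only [hh]; positivity
  have hlim : Tendsto (fun u : ℝ => ∫ w in Ioi u, h w) (𝓝[>] 0) (𝓝 (∫ w in Ioi 0, h w)) := by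
    have : ∀ᶠ u in 𝓝[>] (0 : ℝ), ∫ w in Ioi u, h w = ∫ w in Ioi 0, (Ioi u).indicator h w := by
      filter_upwards [self_mem_nhdsWithin] with u hu
      rw [integral_indicator measurableSet_Ioi, Measure.restrict_restrict measurableSet_Ioi,
        inter_eq_left.2 (Ioi_subset_Ioi (le_of_lt hu))]
    refine Tendsto.congr' (EventuallyEq.symm this) ?_
    refine tendsto_integral_filter_of_dominated_convergence (fun w => ‖h w‖) ?_ ?_ hi.norm ?_
    · exact Eventually.of_forall fun u => hi.aestronglyMeasurable.indicator measurableSet_Ioi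
    · exact Eventually.of_forall fun u => Eventually.of_forall fun w => norm_indicator_le_norm_self _ _
    · refine (ae_restrict_iff' measurableSet_Ioi).2 (Eventually.of_forall fun w hw => ?_)
      refine tendsto_const_nhds.congr' ?_
      filter_upwards [nhdsWithin_le_nhds (Iio_mem_nhds hw)] with u hu
      rw [indicator_of_mem (mem_Ioi.2 hu)]
  refine ⟨∫ w in Ioi 0, h w, ?_, fun x hx => ?_⟩
  · rw [setIntegral_pos_iff_support_of_nonneg_ae _ hi]
    · have : Function.support h ∩ Ioi 0 = Ioi 0 :=
        inter_eq_right.2 fun w hw => (hpos w hw).ne'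
      rw [this]; simp
    · exact (ae_restrict_iff' measurableSet_Ioi).2 (Eventually.of_forall fun w hw => (hpos w hw).le)
  rcases hx.eq_or_lt with rfl | hx
  · simp [Real.zero_rpow h0.ne']
  have hu : Tendsto (fun n : ℕ => x * (n : ℝ) ^ (-α⁻¹)) atTop (𝓝[>] 0) := by
    refine tendsto_nhdsWithin_iff.2 ⟨?_, ?_⟩
    · have := ((tendsto_rpow_neg_atTop (inv_pos.2 h0)).comp tendsto_natCast_atTop_atTop).const_mul x
      simpa using! this
    · filter_upwards [eventually_gt_atTop 0] with n hn
      have : (0 : ℝ) < n := by exact_mod_cast hn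
      simp only [mem_Ioi]; positivity
  have key := Real.tendsto_one_add_pow_exp_of_tendsto
    (g := fun n : ℕ => (∫ v, Real.exp (-(x * (n : ℝ) ^ (-α⁻¹) * v)) ∂(paretoMeasure 1 α)) - 1)
    (t := -((∫ w in Ioi 0, h w) * x ^ α)) ?_
  · simpa using key
  have h2 := ((hlim.comp hu).mul_const (x ^ α)).neg
  refine h2.congr' ?_
  filter_upwards [eventually_gt_atTop 0] with n hn
  have hn' : (0 : ℝ) < n := by exact_mod_cast hn
  have e := one_sub_laplace_pareto h0 (u := x * (n : ℝ) ^ (-α⁻¹)) (by positivity)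
  rw [Real.mul_rpow hx.le (by positivity), ← Real.rpow_mul hn'.le, neg_mul,
    inv_mul_cancel₀ h0.ne', Real.rpow_neg_one] at e
  simp only [Function.comp]
  rw [show (∫ v, Real.exp (-(x * (n : ℝ) ^ (-α⁻¹) * v)) ∂(paretoMeasure 1 α)) - 1
    = -(x ^ α * (n : ℝ)⁻¹ * ∫ w in Ioi (x * (n : ℝ) ^ (-α⁻¹)), h w) by rw [← e]; ring]
  field_simp

theorem exists_charFun {E : Type*} [NormedAddCommGroup E] [InnerProductSpace ℝ E]
    [FiniteDimensional ℝ E] [MeasurableSpace E] [BorelSpace E] {s σ : ℝ} (h0 : 0 < s) (h2 : s ≤ 2)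
    (hσ : 0 ≤ σ) :
    ∃ μ : ProbabilityMeasure E, ∀ t,
      charFun (μ : Measure E) t = ((Real.exp (-(σ * ‖t‖ ^ s)) : ℝ) : ℂ) := by
  obtain ⟨K, hK, ν, hν⟩ : ∃ K : ℝ, 0 < K ∧ ∃ ν : ProbabilityMeasure E, ∀ t,
      charFun (ν : Measure E) t = ((Real.exp (-(K * ‖t‖ ^ s)) : ℝ) : ℂ) := by
    rcases h2.eq_or_lt with rfl | h2
    · refine ⟨1 / 2, by norm_num, ⟨stdGaussian E, inferInstance⟩, fun t => ?_⟩
      rw [ProbabilityMeasure.coe_mk, charFun_stdGaussian]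
      push_cast
      rw [Real.rpow_two]
      push_cast
      congr 1; ring
    have ha0 : 0 < s / 2 := by linarith
    obtain ⟨K, hK, hlim⟩ := exists_laplace ha0 (by linarith : s / 2 < 1)
    have := isProbabilityMeasure_paretoMeasure (t := 1) (r := s / 2) one_pos ha0
    have hae : ∀ᵐ v ∂(paretoMeasure 1 (s / 2)), 0 ≤ v := by
      rw [paretoMeasure, ae_withDensity_iff (by unfold paretoPDF; fun_prop)]
      refine Eventually.of_forall fun v hv => ?_
      by_contra hneg
      exact hv (paretoPDF_of_lt (by linarith))
    obtain ⟨ρ, hρ⟩ := exists_mixture (E := E) (paretoMeasure 1 (s / 2)) hae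
    have : ∀ n : ℕ, ∃ μ : ProbabilityMeasure E, ∀ t, charFun (μ : Measure E) t
        = (((∫ v, Real.exp (-(‖t‖ ^ 2 * (n : ℝ) ^ (-(s / 2)⁻¹) * v))
          ∂(paretoMeasure 1 (s / 2))) ^ n : ℝ) : ℂ) := fun n => by
      obtain ⟨μ₁, hμ₁⟩ := exists_smul_charFun ρ (Real.sqrt ((n : ℝ) ^ (-(s / 2)⁻¹)))
      obtain ⟨μ₂, hμ₂⟩ := exists_pow_charFun μ₁ n
      refine ⟨μ₂, fun t => ?_⟩
      rw [hμ₂, hμ₁, hρ, norm_smul, mul_pow, Real.norm_of_nonneg (Real.sqrt_nonneg _),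
        Real.sq_sqrt (by positivity)]
      simp only [mul_comm, Complex.ofReal_pow]
    choose ν hν using this
    refine ⟨K, hK, exists_of_tendsto_charFun ν _ ?_ fun t => ?_⟩
    · have : Continuous fun t : E => ‖t‖ ^ s :=
        continuous_norm.rpow_const fun _ => Or.inr h0.le
      exact Continuous.continuousAt (by fun_prop)
    · simp_rw [hν]
      have := hlim (‖t‖ ^ 2) (by positivity)
      rw [← Real.rpow_natCast ‖t‖ 2, ← Real.rpow_mul (norm_nonneg t)] at this
      have h3 := (Complex.continuous_ofReal.tendsto _).comp this
      convert! h3 using 1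
      · ext n; simp
      · congr; push_cast; ring
  obtain ⟨μ, hμ⟩ := exists_smul_charFun ν ((σ / K) ^ s⁻¹)
  refine ⟨μ, fun t => ?_⟩
  rw [hμ, hν, norm_smul, Real.norm_of_nonneg (by positivity), Real.mul_rpow (by positivity)
    (norm_nonneg t), ← Real.rpow_mul (by positivity), inv_mul_cancel₀ h0.ne', Real.rpow_one]
  congr 3
  field_simp

end StableLaw

/-! ### The stable measures on the scalar field and their products -/

theorem StableLaw.exists_scalar (𝕜 : Type*) [RCLike 𝕜] {s σ : ℝ}
    (h : 0 < s ∧ s ≤ 2 ∧ 0 < σ) :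
    ∃ μ : ProbabilityMeasure 𝕜, ∀ w : 𝕜,
      ∫ z, Complex.exp ((RCLike.re ((starRingEnd 𝕜) w * z) : ℝ) * Complex.I) ∂(μ : Measure 𝕜)
        = ((Real.exp (-(σ * ‖w‖ ^ s)) : ℝ) : ℂ) := by
  let _ : InnerProductSpace ℝ 𝕜 :=
    { (inferInstance : NormedSpace ℝ 𝕜) with
      inner := fun x y => RCLike.re (inner 𝕜 x y)
      norm_sq_eq_re_inner := fun x => norm_sq_eq_re_inner (𝕜 := 𝕜) x
      conj_inner_symm := fun _ _ => inner_re_symm _ _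
      add_left := fun x y z => by simp only [inner_add_left, map_add]
      smul_left := fun x y a => by
        simp [RCLike.real_smul_eq_coe_mul, mul_left_comm]
        ring }
  obtain ⟨μ, hμ⟩ := StableLaw.exists_charFun (E := 𝕜) h.1 h.2.1 h.2.2.le
  refine ⟨μ, fun w => ?_⟩
  rw [← hμ w, charFun_apply]
  refine integral_congr_ae (Eventually.of_forall fun z => ?_)
  have : inner ℝ z w = RCLike.re ((starRingEnd 𝕜) w * z) := by
    rw [real_inner_comm]
    change RCLike.re (inner 𝕜 w z) = _
    rw [RCLike.inner_apply, mul_comm]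
  simp only [this]

open Classical in
/-- The rotation invariant `s`-stable (Lévy) probability measure `μ_s` on `𝕜 = ℝ` or `ℂ`, for
`0 < s ≤ 2`, with scale parameter `σ > 0`: the unique probability measure whose characteristic
function is `w ↦ exp (-σ |w| ^ s)` (see `stableMeasure_spec`). For `s = 2` it is the centred
(isotropic) Gaussian measure; every normalization in use corresponds to some value of `σ`. -/
noncomputable def stableMeasure (𝕜 : Type*) [RCLike 𝕜] (s σ : ℝ) : Measure 𝕜 :=
  if h : 0 < s ∧ s ≤ 2 ∧ 0 < σ then (StableLaw.exists_scalar 𝕜 h).choose else 0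

theorem stableMeasure_spec (𝕜 : Type*) [RCLike 𝕜] {s σ : ℝ} (h : 0 < s ∧ s ≤ 2 ∧ 0 < σ) :
    IsProbabilityMeasure (stableMeasure 𝕜 s σ) ∧ ∀ w : 𝕜,
      ∫ z, Complex.exp ((RCLike.re ((starRingEnd 𝕜) w * z) : ℝ) * Complex.I) ∂(stableMeasure 𝕜 s σ)
        = ((Real.exp (-(σ * ‖w‖ ^ s)) : ℝ) : ℂ) := by
  rw [stableMeasure, dif_pos h]
  exact ⟨inferInstance, (StableLaw.exists_scalar 𝕜 h).choose_spec⟩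

/-- The `s`-stable measure `μ_s^N` on `𝕜^N`: the `N`-fold product of `μ_s`. -/
noncomputable def stableMeasurePi (𝕜 : Type*) [RCLike 𝕜] (s σ : ℝ) (N : ℕ) :
    Measure (Fin N → 𝕜) :=
  Measure.pi fun _ => stableMeasure 𝕜 s σ

/-! ### Multiple summing operators -/

/-- The weak `p`-norm `w_p(y) = sup_{‖γ‖ ≤ 1} (∑ j, |γ (y j)| ^ p) ^ (1 / p)` of a finite sequence,
the supremum being over the closed unit ball of the dual. -/
noncomputable def weakSeqNorm (𝕜 : Type*) [RCLike 𝕜] {E : Type*} [NormedAddCommGroup E]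
    [NormedSpace 𝕜 E] (p : ℝ) {J : ℕ} (y : Fin J → E) : ℝ≥0∞ :=
  ⨆ (γ : StrongDual 𝕜 E) (_ : ‖γ‖ ≤ 1), (∑ j, ‖γ (y j)‖ₑ ^ p) ^ (1 / p)

/-- `C` is an admissible constant in the definition of multiple `p`-summability of `T`. -/
def IsMultipleSummingBound {𝕜 : Type*} [RCLike 𝕜] {m : ℕ} {E : Fin m → Type*}
    [∀ k, NormedAddCommGroup (E k)] [∀ k, NormedSpace 𝕜 (E k)] {F : Type*} [NormedAddCommGroup F]
    [NormedSpace 𝕜 F] (p : ℝ) (T : ContinuousMultilinearMap 𝕜 E F) (C : ℝ≥0) : Prop :=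
  ∀ (J : Fin m → ℕ) (x : ∀ k, Fin (J k) → E k),
    (∑ j : ∀ k, Fin (J k), ‖T fun k => x k (j k)‖ₑ ^ p) ^ (1 / p)
      ≤ C * ∏ k, weakSeqNorm 𝕜 p (x k)

/-- `T` is multiple `p`-summing. -/
def IsMultipleSumming {𝕜 : Type*} [RCLike 𝕜] {m : ℕ} {E : Fin m → Type*}
    [∀ k, NormedAddCommGroup (E k)] [∀ k, NormedSpace 𝕜 (E k)] {F : Type*} [NormedAddCommGroup F]
    [NormedSpace 𝕜 F] (p : ℝ) (T : ContinuousMultilinearMap 𝕜 E F) : Prop :=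
  ∃ C : ℝ≥0, 0 < C ∧ IsMultipleSummingBound p T C

/-- The multiple `p`-summing norm `π_p(T)`, the infimum of the admissible constants `C > 0`
(with value `∞` if `T` is not multiple `p`-summing). -/
noncomputable def multipleSummingNorm {𝕜 : Type*} [RCLike 𝕜] {m : ℕ} {E : Fin m → Type*}
    [∀ k, NormedAddCommGroup (E k)] [∀ k, NormedSpace 𝕜 (E k)] {F : Type*} [NormedAddCommGroup F]
    [NormedSpace 𝕜 F] (p : ℝ) (T : ContinuousMultilinearMap 𝕜 E F) : ℝ≥0∞ :=
  ⨅ (C : ℝ≥0) (_ : 0 < C ∧ IsMultipleSummingBound p T C), (C : ℝ≥0∞)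

/-! ### `ℒ_q^g`-spaces -/

/-- `X` is an `ℒ_{q,lam}^g`-space: for every finite dimensional subspace `M` of `X` and every
`ε > 0` the inclusion `M → X` factors as `S ∘ R` through some `ℓ_q^n` with
`‖S‖ * ‖R‖ ≤ lam + ε`. -/
def IsLgSpaceWith (𝕜 : Type*) [RCLike 𝕜] (q : ℝ≥0∞) [Fact (1 ≤ q)] (lam : ℝ) (X : Type*)
    [NormedAddCommGroup X] [NormedSpace 𝕜 X] : Prop :=
  ∀ M : Submodule 𝕜 X, FiniteDimensional 𝕜 M → ∀ ε : ℝ, 0 < ε →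
    ∃ (n : ℕ) (R : M →L[𝕜] PiLp q (fun _ : Fin n => 𝕜)) (S : PiLp q (fun _ : Fin n => 𝕜) →L[𝕜] X),
      (∀ x : M, S (R x) = x) ∧ ‖S‖ * ‖R‖ ≤ lam + ε

/-- `X` is an `ℒ_q^g`-space: it is an `ℒ_{q,lam}^g`-space for some `1 ≤ lam < ∞`. -/
def IsLgSpace (𝕜 : Type*) [RCLike 𝕜] (q : ℝ≥0∞) [Fact (1 ≤ q)] (X : Type*)
    [NormedAddCommGroup X] [NormedSpace 𝕜 X] : Prop :=
  ∃ lam : ℝ, 1 ≤ lam ∧ IsLgSpaceWith 𝕜 q lam X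

/-! ### The integral norm -/

/-- For `T` an `m`-linear operator on `ℓ_r^N`, the quantity
`(∫ ‖T(z⁽¹⁾, …, z⁽ᵐ⁾)‖ ^ p d(μ_s^N × ⋯ × μ_s^N)(z⁽¹⁾, …, z⁽ᵐ⁾)) ^ (1 / p)`. -/
noncomputable def stableIntegralNorm {𝕜 : Type*} [RCLike 𝕜] {r : ℝ≥0∞} [Fact (1 ≤ r)] {m N : ℕ}
    {X : Type*} [NormedAddCommGroup X] [NormedSpace 𝕜 X] (s σ p : ℝ)
    (T : ContinuousMultilinearMap 𝕜 (fun _ : Fin m => PiLp r (fun _ : Fin N => 𝕜)) X) : ℝ≥0∞ :=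
  (∫⁻ z : Fin m → Fin N → 𝕜, ‖T fun k => WithLp.toLp r (z k)‖ₑ ^ p
    ∂(Measure.pi fun _ : Fin m => stableMeasurePi 𝕜 s σ N)) ^ (1 / p)

end

open scoped ENNReal NNReal

open scoped ENNReal NNReal
open MeasureTheory ProbabilityTheory

/-! Everything rests on stability. For `z` distributed as `μ_s^N`, the sum `∑ a_i z_i` has the law
of `‖a‖_s z_1`. The dual of `ℓ_r^N` is `ℓ_{r'}^N`, so for `s = r'` every functional satisfies `∫
|γ(z)|^p = K ‖γ‖^p`, where `K` is the `p`-th moment of `μ_{r'}` (`lintegral_dual_piLp`). `K` is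
positive, and it is finite when `p < r'` or `r' = 2`. Thus the identity on `ℓ_r^N` behaves like a
continuous family of vectors whose weak `p`-norm is `K^{1/p}`, whatever `N` is.

Lower bound: test a multiple summing operator on this family. Simple functions approximate it, and
the `p`-th roots of the probabilities of their values serve as weights
(`IsMultipleSummingBound.lintegral_simpleFunc_le`). Fatou's lemma then gives the integral
inequality. The target space plays no role.

Upper bound: for a functional, `∑ |φ(x_j)|^p ≤ w_p(x)^p ‖φ‖^p = K⁻¹ w_p(x)^p ∫ |φ(z)|^p`. This
passes to operators into `ℓ_q^n` with constants free of `n`. If `q ≤ p`, Minkowski's inequality is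
applied to the coordinate functionals. If `p < q ≤ 2`, a `q`-stable measure embeds `ℓ_q^n` into
`L_p`, and the scalar estimate is integrated over random functionals. The local factorization
carries the estimate over to `X`, and Fubini handles the `m` variables one by one, at the cost of
one factor `D` each (`IsStableSummingBound.sum_multilinear_le`).

That `T` is multiple summing at all is a crude consequence of finite dimension. -/

theorem ENNReal.sum_rpow_le_card_rpow_mul {ι : Type*} (s : Finset ι) (f : ι → ℝ≥0∞) {p : ℝ}
    (hp : 0 < p) : (∑ i ∈ s, f i) ^ p ≤ (s.card : ℝ≥0∞) ^ p * ∑ i ∈ s, f i ^ p := by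
  rcases s.eq_empty_or_nonempty with rfl | hs
  · simp [hp]
  obtain ⟨i, hi, hmax⟩ := s.exists_max_image f hs
  -- Comparison with the largest term treats `p < 1` and `p ≥ 1` alike.
  calc (∑ i ∈ s, f i) ^ p ≤ (s.card * f i) ^ p := by
        refine ENNReal.rpow_le_rpow ?_ hp.le
        simpa using Finset.sum_le_card_nsmul s f (f i) hmax
    _ = (s.card : ℝ≥0∞) ^ p * f i ^ p := ENNReal.mul_rpow_of_nonneg _ _ hp.le
    _ ≤ _ := by
        gcongr
        exact Finset.single_le_sum_of_canonicallyOrdered (f := fun i => f i ^ p) hi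

theorem ENNReal.add_rpow_le_two_rpow_mul {p : ℝ} (hp : 0 < p) (a b : ℝ≥0∞) :
    (a + b) ^ p ≤ 2 ^ p * (a ^ p + b ^ p) := by
  simpa using ENNReal.sum_rpow_le_card_rpow_mul Finset.univ ![a, b] hp

/-! ### Stable laws: stability and absolute moments -/

theorem RCLike.secondCountableTopology (𝕜 : Type*) [RCLike 𝕜] : SecondCountableTopology 𝕜 :=
  have := FiniteDimensional.proper ℝ 𝕜
  inferInstance

/-- With the real inner product `Re (conj w * z)` on `𝕜`, these integrals are characteristic
functions, which determine a finite measure. -/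
theorem MeasureTheory.Measure.ext_of_integral_cexp_re {𝕜 : Type*} [RCLike 𝕜] {μ ν : Measure 𝕜}
    [IsFiniteMeasure μ] [IsFiniteMeasure ν]
    (h : ∀ w : 𝕜, ∫ z, Complex.exp ((RCLike.re ((starRingEnd 𝕜) w * z) : ℝ) * Complex.I) ∂μ
      = ∫ z, Complex.exp ((RCLike.re ((starRingEnd 𝕜) w * z) : ℝ) * Complex.I) ∂ν) :
    μ = ν := by
  let _ : InnerProductSpace ℝ 𝕜 := InnerProductSpace.rclikeToReal 𝕜 𝕜
  have e : ∀ z w : 𝕜, inner ℝ z w = RCLike.re ((starRingEnd 𝕜) w * z) := fun z w => by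
    rw [real_inner_comm]
    change RCLike.re (inner 𝕜 w z) = _
    rw [RCLike.inner_apply, mul_comm]
  have := RCLike.secondCountableTopology 𝕜
  refine Measure.ext_of_charFun (funext fun w => ?_)
  simp only [charFun_apply, e]
  exact h w

/-- The absolute `p`-th moment of the stable measure. -/
noncomputable def stableMoment (𝕜 : Type*) [RCLike 𝕜] (s σ p : ℝ) : ℝ≥0∞ :=
  ∫⁻ z, ‖z‖ₑ ^ p ∂(stableMeasure 𝕜 s σ)

/-- Real-linear images of the stable law are real `s`-stable laws, so moment questions reduce to the
line. -/
theorem charFun_map_re_stableMeasure (𝕜 : Type*) [RCLike 𝕜] {s σ : ℝ} (h : 0 < s ∧ s ≤ 2 ∧ 0 < σ)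
    (w : 𝕜) (t : ℝ) :
    charFun ((stableMeasure 𝕜 s σ).map fun z => RCLike.re ((starRingEnd 𝕜) w * z)) t
      = ((Real.exp (-(σ * ‖w‖ ^ s * |t| ^ s)) : ℝ) : ℂ) := by
  have hm : Measurable fun z : 𝕜 => RCLike.re ((starRingEnd 𝕜) w * z) := by fun_prop
  rw [charFun_apply_real, integral_map hm.aemeasurable
    (Measurable.aestronglyMeasurable (by fun_prop))]
  have := (stableMeasure_spec 𝕜 h).2 ((t : 𝕜) * w)
  rw [norm_mul, RCLike.norm_ofReal, Real.mul_rpow (abs_nonneg _) (norm_nonneg _)] at this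
  rw [show σ * ‖w‖ ^ s * |t| ^ s = σ * (|t| ^ s * ‖w‖ ^ s) by ring, ← this]
  refine integral_congr_ae (Filter.Eventually.of_forall fun z => ?_)
  simp only [map_mul, RCLike.conj_ofReal, mul_assoc, RCLike.re_ofReal_mul, Complex.ofReal_mul]

/-- The stability property. By independence the characteristic function of the sum is `∏ exp (-σ
|a_i|^s |w|^s)`, which is that of one variable scaled by the `ℓ_s` norm of `a`. -/
theorem map_sum_stableMeasurePi (𝕜 : Type*) [RCLike 𝕜] {s σ : ℝ} (h : 0 < s ∧ s ≤ 2 ∧ 0 < σ)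
    {N : ℕ} (a : Fin N → 𝕜) :
    (stableMeasurePi 𝕜 s σ N).map (fun z => ∑ i, a i * z i)
      = (stableMeasure 𝕜 s σ).map (fun z => (((∑ i, ‖a i‖ ^ s) ^ (1 / s) : ℝ) : 𝕜) * z) := by
  obtain ⟨hP, hc⟩ := stableMeasure_spec 𝕜 h
  have : IsProbabilityMeasure (stableMeasurePi 𝕜 s σ N) := by
    unfold stableMeasurePi; infer_instance
  have hm1 : Measurable fun z : Fin N → 𝕜 => ∑ i, a i * z i := by fun_prop
  have hm2 : Measurable fun z : 𝕜 => (((∑ i, ‖a i‖ ^ s) ^ (1 / s) : ℝ) : 𝕜) * z := by fun_prop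
  have := Measure.isProbabilityMeasure_map hm1.aemeasurable (μ := stableMeasurePi 𝕜 s σ N)
  have := Measure.isProbabilityMeasure_map hm2.aemeasurable (μ := stableMeasure 𝕜 s σ)
  refine Measure.ext_of_integral_cexp_re fun w => ?_
  rw [integral_map hm1.aemeasurable (Measurable.aestronglyMeasurable (by fun_prop)),
    integral_map hm2.aemeasurable (Measurable.aestronglyMeasurable (by fun_prop))]
  have e1 : ∀ z : Fin N → 𝕜,
      Complex.exp ((RCLike.re ((starRingEnd 𝕜) w * ∑ i, a i * z i) : ℝ) * Complex.I)
      = ∏ i, Complex.exp ((RCLike.re ((starRingEnd 𝕜) ((starRingEnd 𝕜) (a i) * w) * z i) : ℝ)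
        * Complex.I) := fun z => by
    rw [← Complex.exp_sum, ← Finset.sum_mul, Finset.mul_sum, map_sum]
    push_cast
    congr 2
    refine Finset.sum_congr rfl fun i _ => ?_
    rw [map_mul (starRingEnd 𝕜), RCLike.conj_conj]
    congr 2
    ring
  simp_rw [e1]
  have e2 : ∀ z : 𝕜,
      Complex.exp ((RCLike.re ((starRingEnd 𝕜) w *
        ((((∑ i, ‖a i‖ ^ s) ^ (1 / s) : ℝ) : 𝕜) * z)) : ℝ) * Complex.I)
      = Complex.exp ((RCLike.re ((starRingEnd 𝕜)
        ((((∑ i, ‖a i‖ ^ s) ^ (1 / s) : ℝ) : 𝕜) * w) * z) : ℝ) * Complex.I) := fun z => by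
    rw [map_mul (starRingEnd 𝕜), RCLike.conj_ofReal]
    congr 4
    ring
  simp_rw [e2]
  rw [hc]
  have hS : 0 ≤ ∑ i, ‖a i‖ ^ s := Finset.sum_nonneg fun i _ => by positivity
  rw [stableMeasurePi, integral_fintype_prod_eq_prod (μ := fun _ => stableMeasure 𝕜 s σ)
    (fun i z => Complex.exp ((RCLike.re ((starRingEnd 𝕜) ((starRingEnd 𝕜) (a i) * w) * z) : ℝ)
        * Complex.I))]
  simp_rw [hc]
  rw [← Complex.ofReal_prod, ← Real.exp_sum, norm_mul, RCLike.norm_ofReal,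
    abs_of_nonneg (by positivity), Real.mul_rpow (by positivity) (norm_nonneg _),
    ← Real.rpow_mul hS, one_div_mul_cancel h.1.ne', Real.rpow_one]
  congr 2
  rw [Finset.sum_neg_distrib, ← Finset.mul_sum, Finset.sum_mul]
  congr 2
  refine Finset.sum_congr rfl fun i _ => ?_
  rw [norm_mul, RCLike.norm_conj, Real.mul_rpow (norm_nonneg _) (norm_nonneg _)]

/-- Serves two purposes: with `s = r'` it evaluates functionals on `ℓ_r^N`, and with `s = q` it
embeds `ℓ_q^n` into `L_p`. -/
theorem lintegral_sum_stableMeasurePi (𝕜 : Type*) [RCLike 𝕜] {s σ p : ℝ}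
    (h : 0 < s ∧ s ≤ 2 ∧ 0 < σ) (hp : 0 < p) {N : ℕ} (a : Fin N → 𝕜) :
    ∫⁻ z, ‖∑ i, a i * z i‖ₑ ^ p ∂(stableMeasurePi 𝕜 s σ N)
      = ((∑ i, ‖a i‖ₑ ^ s) ^ (1 / s)) ^ p * stableMoment 𝕜 s σ p := by
  have h1 : ∫⁻ z, ‖∑ i, a i * z i‖ₑ ^ p ∂(stableMeasurePi 𝕜 s σ N)
      = ∫⁻ y, ‖y‖ₑ ^ p ∂((stableMeasurePi 𝕜 s σ N).map (fun z => ∑ i, a i * z i)) := by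
    rw [lintegral_map (by fun_prop) (by fun_prop)]
  rw [h1, map_sum_stableMeasurePi 𝕜 h, lintegral_map (by fun_prop) (by fun_prop)]
  simp_rw [enorm_mul]
  simp_rw [ENNReal.mul_rpow_of_nonneg _ _ hp.le]
  rw [lintegral_const_mul _ (by fun_prop), stableMoment]
  congr 2
  have hS : 0 ≤ ∑ i, ‖a i‖ ^ s := Finset.sum_nonneg fun i _ => by positivity
  rw [← ofReal_norm, RCLike.norm_ofReal, abs_of_nonneg (by positivity),
    ← ENNReal.ofReal_rpow_of_nonneg hS (by have := h.1; positivity),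
    ENNReal.ofReal_sum_of_nonneg fun i _ => by positivity]
  congr 1
  refine Finset.sum_congr rfl fun i _ => ?_
  rw [← ofReal_norm, ENNReal.ofReal_rpow_of_nonneg (norm_nonneg _) h.1.le]

/-- A vanishing moment would force the measure to be concentrated at `0`, with characteristic
function `1`, whereas its value at `w = 1` is `exp (-σ) < 1`. -/
theorem stableMoment_ne_zero (𝕜 : Type*) [RCLike 𝕜] {s σ p : ℝ} (h : 0 < s ∧ s ≤ 2 ∧ 0 < σ)
    (hp : 0 < p) : stableMoment 𝕜 s σ p ≠ 0 := by
  obtain ⟨hP, hc⟩ := stableMeasure_spec 𝕜 h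
  intro h0
  rw [stableMoment, lintegral_eq_zero_iff (by fun_prop)] at h0
  have h1 := hc 1
  have h2 : ∫ z, Complex.exp ((RCLike.re ((starRingEnd 𝕜) 1 * z) : ℝ) * Complex.I)
      ∂(stableMeasure 𝕜 s σ) = ∫ z, 1 ∂(stableMeasure 𝕜 s σ) := by
    refine integral_congr_ae ?_
    filter_upwards [h0] with z hz
    have : z = 0 := by simpa [ENNReal.rpow_eq_zero_iff, hp, hp.le, not_lt.2 hp.le] using hz
    simp [this]
  rw [h2] at h1
  have h3 : Real.exp (-(σ * ‖(1 : 𝕜)‖ ^ s)) < 1 := by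
    have := h.2.2
    simpa using this
  have h4 : (1 : ℝ) = Real.exp (-(σ * ‖(1 : 𝕜)‖ ^ s)) := by
    have : (1 : ℂ) = ((Real.exp (-(σ * ‖(1 : 𝕜)‖ ^ s)) : ℝ) : ℂ) := by
      simpa only [integral_const, probReal_univ, one_smul] using h1
    exact_mod_cast this
  linarith

/-- The tail is controlled by the integral of `1 - charFun` over `[-2/R, 2/R]`, and `1 - exp (-u) ≤
u` there. -/
theorem measure_abs_gt_le_of_charFun {ν : Measure ℝ} [IsProbabilityMeasure ν] {s κ : ℝ} (hs : 0 < s)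
    (hκ : 0 ≤ κ) (hν : ∀ t, charFun ν t = ((Real.exp (-(κ * |t| ^ s)) : ℝ) : ℂ)) {R : ℝ}
    (hR : 0 < R) : ν {x | R < |x|} ≤ ENNReal.ofReal (2 * κ * 2 ^ s * R ^ (-s)) := by
  rw [← ofReal_measureReal]
  refine ENNReal.ofReal_le_ofReal ((measureReal_abs_gt_le_integral_charFun hR).trans ?_)
  have h1 : ‖∫ t in (-2 * R⁻¹)..(2 * R⁻¹), 1 - charFun ν t‖
      ≤ (κ * (2 * R⁻¹) ^ s) * |2 * R⁻¹ - (-2 * R⁻¹)| := by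
    refine intervalIntegral.norm_integral_le_of_norm_le_const fun t ht => ?_
    rw [Set.uIoc_of_le (by have := inv_pos.2 hR; linarith)] at ht
    rw [hν, ← Complex.ofReal_one, ← Complex.ofReal_sub, Complex.norm_real, Real.norm_eq_abs]
    have e0 : 0 ≤ κ * |t| ^ s := by positivity
    have e1 := Real.exp_le_one_iff.2 (neg_nonpos.2 e0)
    have e2 := Real.add_one_le_exp (-(κ * |t| ^ s))
    rw [abs_of_nonneg (by linarith)]
    have e3 : |t| ≤ 2 * R⁻¹ := abs_le.2 ⟨by linarith [ht.1], ht.2⟩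
    have e4 : κ * |t| ^ s ≤ κ * (2 * R⁻¹) ^ s := by gcongr
    linarith
  have h2 : |2 * R⁻¹ - (-2 * R⁻¹)| = 4 * R⁻¹ := by
    have := inv_pos.2 hR
    rw [abs_of_nonneg (by linarith)]; ring
  rw [h2] at h1
  calc 2⁻¹ * R * ‖∫ t in (-2 * R⁻¹)..(2 * R⁻¹), 1 - charFun ν t‖
      ≤ 2⁻¹ * R * ((κ * (2 * R⁻¹) ^ s) * (4 * R⁻¹)) := by gcongr
    _ = 2 * κ * 2 ^ s * R ^ (-s) := by
      rw [Real.mul_rpow (by norm_num) (by positivity), Real.inv_rpow hR.le, Real.rpow_neg hR.le]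
      field_simp
      ring

/-- Layer-cake formula: near `0` the probability is at most `1`, and at infinity the tail bound
leaves `t ^ (p - 1 - s)`, integrable for `p < s`. For `s = 2` the law is Gaussian and has all
moments. -/
theorem lintegral_rpow_lt_top_of_charFun {ν : Measure ℝ} [IsProbabilityMeasure ν] {s κ p : ℝ}
    (hs : 0 < s) (hκ : 0 ≤ κ) (hp : 0 < p) (hps : p < s ∨ s = 2)
    (hν : ∀ t, charFun ν t = ((Real.exp (-(κ * |t| ^ s)) : ℝ) : ℂ)) :
    ∫⁻ x, ‖x‖ₑ ^ p ∂ν < ∞ := by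
  rcases hps with hps | rfl
  · have e : ∀ x : ℝ, ‖x‖ₑ ^ p = ENNReal.ofReal (|x| ^ p) := fun x => by
      rw [← ofReal_norm, Real.norm_eq_abs,
        ENNReal.ofReal_rpow_of_nonneg (abs_nonneg _) hp.le]
    simp_rw [e]
    rw [lintegral_rpow_eq_lintegral_meas_lt_mul ν (Filter.Eventually.of_forall fun x => abs_nonneg x)
      (by fun_prop) hp]
    refine ENNReal.mul_lt_top ENNReal.ofReal_lt_top ?_
    rw [← Set.Ioc_union_Ioi_eq_Ioi zero_le_one]
    refine (lintegral_union_le _ _ _).trans_lt (ENNReal.add_lt_top.2 ⟨?_, ?_⟩)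
    · have hi : IntegrableOn (fun w : ℝ => w ^ (p - 1)) (Set.Ioc 0 1) := by
        rw [← intervalIntegrable_iff_integrableOn_Ioc_of_le zero_le_one]
        exact intervalIntegral.intervalIntegrable_rpow' (by linarith)
      refine lt_of_le_of_lt ?_ hi.lintegral_lt_top
      refine lintegral_mono fun t => ?_
      exact (mul_le_mul_left prob_le_one _).trans (one_mul _).le
    · have hi := (integrableOn_Ioi_rpow_of_lt (a := p - 1 - s) (by linarith) zero_lt_one).const_mul
        (2 * κ * 2 ^ s)
      refine lt_of_le_of_lt ?_ hi.lintegral_lt_top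
      refine setLIntegral_mono' measurableSet_Ioi fun t ht => ?_
      have ht0 : 0 < t := zero_lt_one.trans ht
      refine (mul_le_mul_left (measure_abs_gt_le_of_charFun hs hκ hν ht0) _).trans ?_
      rw [← ENNReal.ofReal_mul (by positivity)]
      refine ENNReal.ofReal_le_ofReal (le_of_eq ?_)
      rw [mul_assoc, ← Real.rpow_add ht0]
      ring_nf
  -- Variance `v` gives `exp (-v t² / 2)`, hence `v = 2 κ`.
  · have : ν = gaussianReal 0 (2 * κ).toNNReal := by
      refine Measure.ext_of_charFun (funext fun t => ?_)
      rw [hν, charFun_gaussianReal]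
      simp only [Real.rpow_two, sq_abs, Complex.ofReal_exp]
      rw [Real.coe_toNNReal _ (by positivity)]
      push_cast
      congr 1; ring
    have hL := memLp_id_gaussianReal (μ := 0) (v := (2 * κ).toNNReal) p.toNNReal
    rw [← this] at hL
    have := lintegral_rpow_enorm_lt_top_of_eLpNorm_lt_top (by simpa using hp) (by simp) hL.2
    simpa [Real.coe_toNNReal _ hp.le] using this

theorem stableMoment_ne_top (𝕜 : Type*) [RCLike 𝕜] {s σ p : ℝ} (h : 0 < s ∧ s ≤ 2 ∧ 0 < σ)
    (hp : 0 < p) (hps : p < s ∨ s = 2) : stableMoment 𝕜 s σ p ≠ ∞ := by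
  obtain ⟨hP, -⟩ := stableMeasure_spec 𝕜 h
  have key : ∀ w : 𝕜, ∫⁻ z, ‖RCLike.re ((starRingEnd 𝕜) w * z)‖ₑ ^ p ∂(stableMeasure 𝕜 s σ) < ∞ := by
    intro w
    have hm : Measurable fun z : 𝕜 => RCLike.re ((starRingEnd 𝕜) w * z) := by fun_prop
    have := Measure.isProbabilityMeasure_map hm.aemeasurable (μ := stableMeasure 𝕜 s σ)
    have := lintegral_rpow_lt_top_of_charFun h.1 (by have := h.2.2; positivity) hp hps
      (charFun_map_re_stableMeasure 𝕜 h w)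
    rwa [lintegral_map (by fun_prop) hm] at this
  have hle : ∀ z : 𝕜, ‖z‖ₑ ^ p ≤ 2 ^ p * (‖RCLike.re ((starRingEnd 𝕜) 1 * z)‖ₑ ^ p
      + ‖RCLike.re ((starRingEnd 𝕜) RCLike.I * z)‖ₑ ^ p) := fun z => by
    have h1 : ‖z‖ₑ ≤ ‖RCLike.re ((starRingEnd 𝕜) 1 * z)‖ₑ
      + ‖RCLike.re ((starRingEnd 𝕜) RCLike.I * z)‖ₑ := by
      simp only [← ofReal_norm]
      rw [← ENNReal.ofReal_add (norm_nonneg _) (norm_nonneg _)]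
      refine ENNReal.ofReal_le_ofReal ?_
      have h2 := norm_add_le ((RCLike.re z : ℝ) : 𝕜) ((RCLike.im z : ℝ) * RCLike.I)
      rw [RCLike.re_add_im, norm_mul, RCLike.norm_ofReal, RCLike.norm_ofReal] at h2
      have h3 : |RCLike.im z| * ‖(RCLike.I : 𝕜)‖ ≤ |RCLike.im z| := by
        -- `I = 0` is the real case.
        rcases eq_or_ne (RCLike.I : 𝕜) 0 with h | h
        · simp [h]
        · simp [RCLike.norm_I_of_ne_zero h]
      simpa using h2.trans (add_le_add_right h3 _)
    exact (ENNReal.rpow_le_rpow h1 hp.le).trans (ENNReal.add_rpow_le_two_rpow_mul hp _ _)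
  refine ((lintegral_mono hle).trans_lt ?_).ne
  rw [lintegral_const_mul _ (by fun_prop), lintegral_add_left (by fun_prop)]
  exact ENNReal.mul_lt_top (ENNReal.rpow_lt_top_of_nonneg hp.le (by simp))
    (ENNReal.add_lt_top.2 ⟨key _, key _⟩)

theorem ENNReal.Lp_sum_le {ι κ : Type*} (s : Finset ι) (t : Finset κ) (f : κ → ι → ℝ≥0∞) {p : ℝ}
    (hp : 1 ≤ p) :
    (∑ i ∈ s, (∑ k ∈ t, f k i) ^ p) ^ (1 / p) ≤ ∑ k ∈ t, (∑ i ∈ s, f k i ^ p) ^ (1 / p) := by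
  classical
  have hp0 : 0 < p := by linarith
  induction t using Finset.induction with
  | empty => simp [hp0]
  | insert a t ha ih =>
    simp only [Finset.sum_insert ha]
    exact (ENNReal.Lp_add_le s _ _ hp).trans (by gcongr)

theorem PiLp.map_toLp_eq_sum {𝕜 : Type*} [RCLike 𝕜] {r : ℝ≥0∞} {F : Type*} [AddCommMonoid F] [Module 𝕜 F] [TopologicalSpace F] {N : ℕ} (γ : PiLp r (fun _ : Fin N => 𝕜) →L[𝕜] F) (z : Fin N → 𝕜) :
    γ (WithLp.toLp r z) = ∑ i, z i • γ (PiLp.single r i 1) := by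
  have : WithLp.toLp r z = ∑ i, z i • PiLp.single r i (1 : 𝕜) := by
    ext j
    simp [Pi.single_apply]
  rw [this, map_sum]
  simp

/-! ### Duality of `ℓ_r^N` and moments of functionals -/

section Dual

variable {𝕜 : Type*} [RCLike 𝕜] {r : ℝ≥0∞} [Fact (1 ≤ r)] {r' : ℝ}

/-- Hölder's inequality bounds the norm from above. An extremal vector for Hölder, with phases
aligned to the coefficients of `γ`, shows that it is attained. -/
theorem norm_dual_piLp (hr : r.HolderConjugate (ENNReal.ofReal r')) {N : ℕ}
    (γ : StrongDual 𝕜 (PiLp r (fun _ : Fin N => 𝕜))) :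
    (∑ i, ‖γ (PiLp.single r i 1)‖ ^ r') ^ (1 / r') = ‖γ‖ := by
  have h1r : 1 ≤ ENNReal.ofReal r' := hr.symm.one_le
  have hr0 : 0 < r' := ENNReal.ofReal_pos.1 (zero_lt_one.trans_le h1r)
  set a : Fin N → 𝕜 := fun i => γ (PiLp.single r i 1) with ha
  have hγ : ∀ z : Fin N → 𝕜, γ (WithLp.toLp r z) = ∑ i, z i * a i := fun z => by
    rw [PiLp.map_toLp_eq_sum]; rfl
  -- Multiplying `g i` by a unimodular `u i` with `u i * a i = ‖a i‖` prevents cancellation in `γ`.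
  have hlow : ∀ g : Fin N → ℝ, (∀ i, 0 ≤ g i) → ∃ x : PiLp r (fun _ : Fin N => 𝕜),
      (∀ i, ‖x i‖ ≤ g i) ∧ ‖γ x‖ = ∑ i, ‖a i‖ * g i := by
    intro g hg
    have hph : ∀ i, ∃ u : 𝕜, ‖u‖ = 1 ∧ u * a i = ‖a i‖ := fun i => by
      rcases eq_or_ne (a i) 0 with h | h
      · exact ⟨1, by simp, by simp [h]⟩
      · have hn : (‖a i‖ : 𝕜) ≠ 0 := by simpa using h
        refine ⟨(starRingEnd 𝕜) (a i) / ‖a i‖, ?_, ?_⟩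
        · rw [norm_div, RCLike.norm_conj, RCLike.norm_ofReal, abs_norm,
            div_self (norm_ne_zero_iff.2 h)]
        · rw [div_mul_eq_mul_div, RCLike.conj_mul, pow_two, mul_div_assoc, div_self hn, mul_one]
    choose u hu hua using hph
    refine ⟨WithLp.toLp r fun i => (g i : 𝕜) * u i, fun i => ?_, ?_⟩
    · simp [hu, abs_of_nonneg (hg i)]
    · rw [hγ]
      have : ∑ i, (g i : 𝕜) * u i * a i = ((∑ i, ‖a i‖ * g i : ℝ) : 𝕜) := by
        push_cast
        exact Finset.sum_congr rfl fun i _ => by rw [mul_assoc, hua, mul_comm]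
      rw [this, RCLike.norm_ofReal, abs_of_nonneg]
      exact Finset.sum_nonneg fun i _ => mul_nonneg (norm_nonneg _) (hg i)
  have hup : ∀ x : PiLp r (fun _ : Fin N => 𝕜), ‖γ x‖ ≤ ∑ i, ‖a i‖ * ‖x i‖ := fun x => by
    have := hγ x.ofLp
    rw [WithLp.toLp_ofLp] at this
    rw [this]
    refine (norm_sum_le _ _).trans (Finset.sum_le_sum fun i _ => ?_)
    rw [norm_mul, mul_comm]
  rcases eq_or_ne r ∞ with rfl | hrt
  · have h1 : r' = 1 := by
      have := (ENNReal.HolderConjugate.eq_top_iff_eq_one ∞ (ENNReal.ofReal r')).1 rfl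
      simpa using this
    subst h1
    simp only [Real.rpow_one, one_div, inv_one]
    refine le_antisymm ?_ (γ.opNorm_le_bound (by positivity) fun x => (hup x).trans ?_)
    · obtain ⟨x, hx, hx'⟩ := hlow (fun _ => 1) fun _ => zero_le_one
      have hx1 : ‖x‖ ≤ 1 := by
        rw [PiLp.norm_eq_ciSup]
        exact Real.iSup_le hx zero_le_one
      have := γ.le_opNorm x
      simp only [mul_one] at hx'
      rw [hx'] at this
      exact this.trans (mul_le_of_le_one_right (norm_nonneg _) hx1)
    · rw [Finset.sum_mul]
      exact Finset.sum_le_sum fun i _ => mul_le_mul_of_nonneg_left (PiLp.norm_apply_le x i)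
        (norm_nonneg _)
  · have hc : r.toReal.HolderConjugate r' := by
      have := ENNReal.HolderConjugate.toReal_of_ne_top (q := ENNReal.ofReal r') hrt (by simp)
      rwa [ENNReal.toReal_ofReal hr0.le] at this
    have hnorm : ∀ x : PiLp r (fun _ : Fin N => 𝕜),
        ‖x‖ = (∑ i, ‖x i‖ ^ r.toReal) ^ (1 / r.toReal) := fun x => PiLp.norm_eq_sum hc.pos x
    refine le_antisymm ?_ (γ.opNorm_le_bound (by positivity) fun x => (hup x).trans ?_)
    -- `g` is the Hölder extremizer: it lies in the unit ball of `ℓ_r` and its pairing with `‖a i‖`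
    -- equals the `ℓ_{r'}` norm of `a`.
    · obtain ⟨⟨g, hg, hg'⟩, -⟩ := NNReal.isGreatest_Lp Finset.univ (fun i => ‖a i‖₊) hc.symm
      obtain ⟨x, hx, hx'⟩ := hlow (fun i => g i) fun i => (g i).2
      have hx1 : ‖x‖ ≤ 1 := by
        rw [hnorm]
        refine Real.rpow_le_one (by positivity) (le_trans ?_ (NNReal.coe_le_coe.2 hg))
          (by have := hc.pos; positivity)
        push_cast
        exact Finset.sum_le_sum fun i _ => Real.rpow_le_rpow (norm_nonneg _) (hx i) hc.nonneg
      have h2 := congrArg ((↑) : ℝ≥0 → ℝ) hg'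
      push_cast at h2
      rw [← h2, ← hx']
      exact (γ.le_opNorm x).trans (mul_le_of_le_one_right (norm_nonneg _) hx1)
    · rw [hnorm]
      have := Real.inner_le_Lp_mul_Lq Finset.univ (fun i => ‖a i‖) (fun i => ‖x i‖) hc.symm
      simpa only [abs_norm] using this

theorem enorm_dual_piLp (hr : r.HolderConjugate (ENNReal.ofReal r')) {N : ℕ}
    (γ : StrongDual 𝕜 (PiLp r (fun _ : Fin N => 𝕜))) :
    (∑ i, ‖γ (PiLp.single r i 1)‖ₑ ^ r') ^ (1 / r') = ‖γ‖ₑ := by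
  have h1r : 1 ≤ ENNReal.ofReal r' := hr.symm.one_le
  have hr0 : 0 < r' := ENNReal.ofReal_pos.1 (zero_lt_one.trans_le h1r)
  rw [← ofReal_norm γ, ← norm_dual_piLp hr, ← ENNReal.ofReal_rpow_of_nonneg
    (Finset.sum_nonneg fun i _ => by positivity) (by positivity),
    ENNReal.ofReal_sum_of_nonneg fun i _ => by positivity]
  congr 1
  refine Finset.sum_congr rfl fun i _ => ?_
  rw [← ofReal_norm, ENNReal.ofReal_rpow_of_nonneg (norm_nonneg _) hr0.le]

/-- Stability with `a_i = γ(e_i)`, whose `ℓ_{r'}` norm is `‖γ‖`; this is why the stability index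
must be `r'`. -/
theorem lintegral_dual_piLp (hr : r.HolderConjugate (ENNReal.ofReal r')) (hr2 : r' ≤ 2)
    {σ p : ℝ} (hσ : 0 < σ) (hp : 0 < p) {N : ℕ} (γ : StrongDual 𝕜 (PiLp r (fun _ : Fin N => 𝕜))) :
    ∫⁻ z, ‖γ (WithLp.toLp r z)‖ₑ ^ p ∂(stableMeasurePi 𝕜 r' σ N)
      = ‖γ‖ₑ ^ p * stableMoment 𝕜 r' σ p := by
  have h1r : 1 ≤ ENNReal.ofReal r' := hr.symm.one_le
  have hr0 : 0 < r' := ENNReal.ofReal_pos.1 (zero_lt_one.trans_le h1r)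
  rw [← enorm_dual_piLp hr γ, ← lintegral_sum_stableMeasurePi 𝕜 ⟨hr0, hr2, hσ⟩ hp]
  refine lintegral_congr fun z => ?_
  rw [PiLp.map_toLp_eq_sum]
  simp only [smul_eq_mul, mul_comm]

end Dual

/-! ### Upper estimate for linear operators -/

section Linear

variable {𝕜 : Type*} [RCLike 𝕜]

theorem sum_enorm_rpow_le_weakSeqNorm {E : Type*} [NormedAddCommGroup E] [NormedSpace 𝕜 E] {p : ℝ}
    (hp : 0 < p) {J : ℕ} (x : Fin J → E) (φ : StrongDual 𝕜 E) :
    ∑ j, ‖φ (x j)‖ₑ ^ p ≤ ‖φ‖ₑ ^ p * weakSeqNorm 𝕜 p x ^ p := by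
  rcases eq_or_ne φ 0 with rfl | hφ
  · simp [hp]
  have hn : ‖φ‖ ≠ 0 := norm_ne_zero_iff.2 hφ
  set γ : StrongDual 𝕜 E := ((‖φ‖ : 𝕜)⁻¹) • φ with hγ
  have hγ1 : ‖γ‖ ≤ 1 := by
    rw [hγ, norm_smul, norm_inv, RCLike.norm_ofReal, abs_norm, inv_mul_cancel₀ hn]
  have hφγ : ∀ y, φ y = (‖φ‖ : 𝕜) * γ y := fun y => by
    have : (‖φ‖ : 𝕜) ≠ 0 := by simpa using hφ
    simp [hγ, this]
  have h1 : (∑ j, ‖γ (x j)‖ₑ ^ p) ^ (1 / p) ≤ weakSeqNorm 𝕜 p x :=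
    le_iSup₂ (f := fun (γ : StrongDual 𝕜 E) (_ : ‖γ‖ ≤ 1) => (∑ j, ‖γ (x j)‖ₑ ^ p) ^ (1 / p)) γ hγ1
  have h2 := ENNReal.rpow_le_rpow h1 hp.le
  rw [← ENNReal.rpow_mul, one_div_mul_cancel hp.ne', ENNReal.rpow_one] at h2
  have h3 : ∀ y, ‖φ y‖ₑ ^ p = ‖φ‖ₑ ^ p * ‖γ y‖ₑ ^ p := fun y => by
    rw [hφγ y, enorm_mul, ENNReal.mul_rpow_of_nonneg _ _ hp.le]
    congr 2
    rw [← ofReal_norm, RCLike.norm_ofReal, abs_norm, ofReal_norm]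
  simp_rw [h3, ← Finset.mul_sum]
  gcongr

/-- `D` bounds the `p`-th power of the ratio between the `p`-summing norm and the stable integral
norm of every linear operator from some `ℓ_r^N` into `X`. -/
def IsStableSummingBound (𝕜 : Type*) [RCLike 𝕜] (r : ℝ≥0∞) [Fact (1 ≤ r)] (s σ p : ℝ) (X : Type*)
    [NormedAddCommGroup X] [NormedSpace 𝕜 X] (D : ℝ≥0∞) : Prop :=
  ∀ (N : ℕ) (T : PiLp r (fun _ : Fin N => 𝕜) →L[𝕜] X) (J : ℕ)
    (x : Fin J → PiLp r (fun _ : Fin N => 𝕜)),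
    ∑ j, ‖T (x j)‖ₑ ^ p ≤ D * weakSeqNorm 𝕜 p x ^ p *
      ∫⁻ z, ‖T (WithLp.toLp r z)‖ₑ ^ p ∂(stableMeasurePi 𝕜 s σ N)

theorem isProbabilityMeasure_stableMeasurePi (𝕜 : Type*) [RCLike 𝕜] {s σ : ℝ}
    (h : 0 < s ∧ s ≤ 2 ∧ 0 < σ) (N : ℕ) : IsProbabilityMeasure (stableMeasurePi 𝕜 s σ N) := by
  have := (stableMeasure_spec 𝕜 h).1
  unfold stableMeasurePi
  infer_instance

theorem continuous_comp_toLp {r : ℝ≥0∞} [Fact (1 ≤ r)] {X : Type*} [NormedAddCommGroup X]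
    [NormedSpace 𝕜 X] {N : ℕ} (T : PiLp r (fun _ : Fin N => 𝕜) →L[𝕜] X) :
    Continuous fun z : Fin N → 𝕜 => T (WithLp.toLp r z) :=
  T.continuous.comp (PiLp.continuous_toLp r _)

variable {r : ℝ≥0∞} [Fact (1 ≤ r)] {r' σ p : ℝ}

theorem PiLp.enorm_rpow_eq_sum {q : ℝ≥0∞} [Fact (1 ≤ q)] (hq : q ≠ ∞) {n : ℕ}
    (y : PiLp q (fun _ : Fin n => 𝕜)) : ‖y‖ₑ ^ q.toReal = ∑ i, ‖y i‖ₑ ^ q.toReal := by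
  have hq0 : 0 < q.toReal := ENNReal.toReal_pos (zero_lt_one.trans_le Fact.out).ne' hq
  rw [← ofReal_norm, PiLp.norm_eq_sum hq0, ENNReal.ofReal_rpow_of_nonneg (by positivity) hq0.le,
    ← Real.rpow_mul (Finset.sum_nonneg fun i _ => by positivity), one_div_mul_cancel hq0.ne',
    Real.rpow_one, ENNReal.ofReal_sum_of_nonneg fun i _ => by positivity]
  refine Finset.sum_congr rfl fun i _ => ?_
  rw [← ofReal_norm, ENNReal.ofReal_rpow_of_nonneg (norm_nonneg _) hq0.le]

/-- Minkowski's inequality handles the operators into `ℓ_q^n` with `q ≤ p`. -/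
theorem isStableSummingBound_piLp_of_le (hr : r.HolderConjugate (ENNReal.ofReal r')) (hr2 : r' ≤ 2)
    (hσ : 0 < σ) (hpr : p < r' ∨ r' = 2) {q : ℝ≥0∞} [Fact (1 ≤ q)] (hq : q ≠ ∞) (hqp : q.toReal ≤ p) (n : ℕ) :
    IsStableSummingBound 𝕜 r r' σ p (PiLp q (fun _ : Fin n => 𝕜))
      ((stableMoment 𝕜 r' σ q.toReal)⁻¹ ^ (p / q.toReal)) := by
  intro N T J x
  have h1r : 1 ≤ ENNReal.ofReal r' := hr.symm.one_le
  have hr0 : 0 < r' := ENNReal.ofReal_pos.1 (zero_lt_one.trans_le h1r)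
  have hq0 : 0 < q.toReal := ENNReal.toReal_pos (zero_lt_one.trans_le Fact.out).ne' hq
  have hp : 0 < p := hq0.trans_le hqp
  have hP := isProbabilityMeasure_stableMeasurePi 𝕜 ⟨hr0, hr2, hσ⟩ N
  have := RCLike.secondCountableTopology 𝕜
  set Q := q.toReal
  set K := stableMoment 𝕜 r' σ Q
  set w := weakSeqNorm 𝕜 p x
  have hK0 : K ≠ 0 := stableMoment_ne_zero 𝕜 ⟨hr0, hr2, hσ⟩ hq0
  have hK : K ≠ ∞ := stableMoment_ne_top 𝕜 ⟨hr0, hr2, hσ⟩ hq0 (hpr.imp_left hqp.trans_lt)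
  set φ : Fin n → StrongDual 𝕜 (PiLp r (fun _ : Fin N => 𝕜)) := fun i =>
    (PiLp.proj q (fun _ : Fin n => 𝕜) i).comp T with hφ
  have hTφ : ∀ y, ‖T y‖ₑ ^ Q = ∑ i, ‖φ i y‖ₑ ^ Q := fun y => PiLp.enorm_rpow_eq_sum hq (T y)
  have hpow : ∀ a : ℝ≥0∞, (a ^ Q) ^ (p / Q) = a ^ p := fun a => by
    rw [← ENNReal.rpow_mul, mul_div_cancel₀ _ hq0.ne']
  have ht1 : 1 ≤ p / Q := (one_le_div hq0).2 hqp
  have ht0 : 0 < p / Q := by positivity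
  -- Minkowski in `ℓ_{p/Q}`, applied to the `Q`-th powers of the coordinates of `T`.
  have h1 : (∑ j, ‖T (x j)‖ₑ ^ p) ^ (1 / (p / Q)) ≤ ∑ i, ‖φ i‖ₑ ^ Q * w ^ Q := by
    simp_rw [← hpow, hTφ]
    refine (ENNReal.Lp_sum_le _ _ _ ht1).trans (Finset.sum_le_sum fun i _ => ?_)
    simp_rw [hpow]
    refine (ENNReal.rpow_le_rpow (sum_enorm_rpow_le_weakSeqNorm hp x (φ i))
      (by positivity)).trans (le_of_eq ?_)
    rw [← ENNReal.mul_rpow_of_nonneg _ _ hp.le, ← ENNReal.rpow_mul,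
      ENNReal.mul_rpow_of_nonneg _ _ (by positivity), show p * (1 / (p / Q)) = Q by field_simp]
  have h2 : K * ∑ i, ‖φ i‖ₑ ^ Q = ∫⁻ z, ‖T (WithLp.toLp r z)‖ₑ ^ Q ∂(stableMeasurePi 𝕜 r' σ N) := by
    simp_rw [hTφ]
    rw [lintegral_finsetSum _ fun i _ => (by
      have := (continuous_comp_toLp (φ i)).measurable
      fun_prop)]
    simp_rw [lintegral_dual_piLp hr hr2 hσ hq0]
    rw [Finset.mul_sum]
    simp_rw [mul_comm]
    rfl
  have h3 : ∑ i, ‖φ i‖ₑ ^ Q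
      ≤ K⁻¹ * ∫⁻ z, ‖T (WithLp.toLp r z)‖ₑ ^ Q ∂(stableMeasurePi 𝕜 r' σ N) := by
    rw [← h2, ← mul_assoc, ENNReal.inv_mul_cancel hK0 hK, one_mul]
  -- On a probability space the `L_Q` norm is at most the `L_p` norm, since `Q ≤ p`.
  have h4 : (∫⁻ z, ‖T (WithLp.toLp r z)‖ₑ ^ Q ∂(stableMeasurePi 𝕜 r' σ N)) ^ (p / Q)
      ≤ ∫⁻ z, ‖T (WithLp.toLp r z)‖ₑ ^ p ∂(stableMeasurePi 𝕜 r' σ N) := by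
    have := eLpNorm'_le_eLpNorm'_of_exponent_le hq0 hqp (stableMeasurePi 𝕜 r' σ N)
      (continuous_comp_toLp T).aestronglyMeasurable
    have := ENNReal.rpow_le_rpow this hp.le
    rw [eLpNorm'_eq_lintegral_enorm, eLpNorm'_eq_lintegral_enorm, ← ENNReal.rpow_mul,
      ← ENNReal.rpow_mul, one_div_mul_cancel hp.ne', ENNReal.rpow_one] at this
    convert this using 2
    ring
  have h5 := ENNReal.rpow_le_rpow h1 ht0.le
  rw [← ENNReal.rpow_mul, one_div_mul_cancel ht0.ne', ENNReal.rpow_one, ← Finset.sum_mul,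
    ENNReal.mul_rpow_of_nonneg _ _ ht0.le, hpow] at h5
  refine h5.trans ?_
  calc (∑ i, ‖φ i‖ₑ ^ Q) ^ (p / Q) * w ^ p
      ≤ (K⁻¹ * ∫⁻ z, ‖T (WithLp.toLp r z)‖ₑ ^ Q ∂(stableMeasurePi 𝕜 r' σ N)) ^ (p / Q) * w ^ p := by
        gcongr
    _ ≤ K⁻¹ ^ (p / Q) * (∫⁻ z, ‖T (WithLp.toLp r z)‖ₑ ^ p ∂(stableMeasurePi 𝕜 r' σ N)) * w ^ p := by
        rw [ENNReal.mul_rpow_of_nonneg _ _ ht0.le]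
        gcongr
    _ = _ := by ring

/-- For `p < q ≤ 2` the space `ℓ_q^n` embeds into `L_p` of a `q`-stable measure. -/
theorem isStableSummingBound_piLp_of_lt (hr : r.HolderConjugate (ENNReal.ofReal r')) (hr2 : r' ≤ 2)
    (hσ : 0 < σ) (hp : 0 < p) (hpr : p < r' ∨ r' = 2) {q : ℝ≥0∞} [Fact (1 ≤ q)] (hpq : p < q.toReal)
    (hq2 : q.toReal ≤ 2) (hq : q ≠ ∞) (n : ℕ) :
    IsStableSummingBound 𝕜 r r' σ p (PiLp q (fun _ : Fin n => 𝕜)) (stableMoment 𝕜 r' σ p)⁻¹ := by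
  intro N T J x
  have h1r : 1 ≤ ENNReal.ofReal r' := hr.symm.one_le
  have hr0 : 0 < r' := ENNReal.ofReal_pos.1 (zero_lt_one.trans_le h1r)
  have hq0 : 0 < q.toReal := hp.trans hpq
  have hP := isProbabilityMeasure_stableMeasurePi 𝕜 ⟨hr0, hr2, hσ⟩ N
  have hP' := isProbabilityMeasure_stableMeasurePi 𝕜 ⟨hq0, hq2, zero_lt_one⟩ n
  have := RCLike.secondCountableTopology 𝕜
  set K := stableMoment 𝕜 r' σ p
  set L := stableMoment 𝕜 q.toReal 1 p
  set w := weakSeqNorm 𝕜 p x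
  have hK0 : K ≠ 0 := stableMoment_ne_zero 𝕜 ⟨hr0, hr2, hσ⟩ hp
  have hK : K ≠ ∞ := stableMoment_ne_top 𝕜 ⟨hr0, hr2, hσ⟩ hp hpr
  have hL0 : L ≠ 0 := stableMoment_ne_zero 𝕜 ⟨hq0, hq2, zero_lt_one⟩ hp
  have hL : L ≠ ∞ := stableMoment_ne_top 𝕜 ⟨hq0, hq2, zero_lt_one⟩ hp (Or.inl hpq)
  set ν := stableMeasurePi 𝕜 q.toReal 1 n
  -- The random functional `y ↦ ∑ ω_i (T y)_i` with `q`-stable `ω`; its `p`-th moment in `ω` is `‖T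
  -- y‖^p` times the constant `L`.
  set φ : (Fin n → 𝕜) → StrongDual 𝕜 (PiLp r (fun _ : Fin N => 𝕜)) := fun ω =>
    (∑ i, ω i • (PiLp.proj q (fun _ : Fin n => 𝕜) i : PiLp q (fun _ : Fin n => 𝕜) →L[𝕜] 𝕜)).comp T
    with hφ
  have hφa : ∀ ω y, φ ω y = ∑ i, T y i * ω i := fun ω y => by
    simp [hφ, mul_comm]
  have hemb : ∀ y, ∫⁻ ω, ‖φ ω y‖ₑ ^ p ∂ν = ‖T y‖ₑ ^ p * L := fun y => by
    simp_rw [hφa]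
    rw [lintegral_sum_stableMeasurePi 𝕜 ⟨hq0, hq2, zero_lt_one⟩ hp, ← PiLp.enorm_rpow_eq_sum hq,
      ← ENNReal.rpow_mul (_ ^ _), ← ENNReal.rpow_mul, ← mul_assoc, mul_one_div_cancel hq0.ne',
      one_mul]
  have h1 : ∀ ω, K * ∑ j, ‖φ ω (x j)‖ₑ ^ p
      ≤ w ^ p * ∫⁻ z, ‖φ ω (WithLp.toLp r z)‖ₑ ^ p ∂(stableMeasurePi 𝕜 r' σ N) := fun ω => by
    rw [lintegral_dual_piLp hr hr2 hσ hp]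
    refine (mul_le_mul_right (sum_enorm_rpow_le_weakSeqNorm hp x (φ ω)) K).trans (le_of_eq ?_)
    ring
  have hmeas : ∀ y, Measurable fun ω => ‖φ ω y‖ₑ ^ p := fun y => by
    simp_rw [hφa]
    fun_prop
  have hjoint : Measurable (Function.uncurry fun (ω : Fin n → 𝕜) (z : Fin N → 𝕜) =>
      ‖φ ω (WithLp.toLp r z)‖ₑ ^ p) := by
    have : Continuous fun v : (Fin n → 𝕜) × (Fin N → 𝕜) =>
        ∑ i, T (WithLp.toLp r v.2) i * v.1 i := by
      refine continuous_finsetSum _ fun i _ => Continuous.mul ?_ (by fun_prop)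
      exact (PiLp.continuous_apply q _ i).comp ((continuous_comp_toLp T).comp continuous_snd)
    have := this.measurable
    simp only [Function.uncurry_def, hφa]
    fun_prop
  -- The scalar inequality is integrated over `ω`; Tonelli turns both sides back into norms of `T`.
  have h2 : K * (L * ∑ j, ‖T (x j)‖ₑ ^ p)
      ≤ L * (w ^ p * ∫⁻ z, ‖T (WithLp.toLp r z)‖ₑ ^ p ∂(stableMeasurePi 𝕜 r' σ N)) := by
    calc K * (L * ∑ j, ‖T (x j)‖ₑ ^ p) = ∫⁻ ω, K * ∑ j, ‖φ ω (x j)‖ₑ ^ p ∂ν := by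
          rw [lintegral_const_mul _ (by fun_prop), lintegral_finsetSum _ fun j _ => hmeas _,
            Finset.mul_sum]
          simp_rw [hemb, mul_comm]
      _ ≤ ∫⁻ ω, w ^ p * ∫⁻ z, ‖φ ω (WithLp.toLp r z)‖ₑ ^ p ∂(stableMeasurePi 𝕜 r' σ N) ∂ν :=
          lintegral_mono h1
      _ = w ^ p * ∫⁻ z, ∫⁻ ω, ‖φ ω (WithLp.toLp r z)‖ₑ ^ p ∂ν ∂(stableMeasurePi 𝕜 r' σ N) := by
          rw [lintegral_const_mul _ hjoint.lintegral_prod_right,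
            lintegral_lintegral_swap hjoint.aemeasurable]
      _ = _ := by
          simp_rw [hemb]
          rw [lintegral_mul_const _ (by
            have := (continuous_comp_toLp T).enorm.measurable
            fun_prop)]
          ring
  calc ∑ j, ‖T (x j)‖ₑ ^ p = K⁻¹ * (L⁻¹ * (K * (L * ∑ j, ‖T (x j)‖ₑ ^ p))) := by
        rw [mul_left_comm K, ← mul_assoc L⁻¹, ENNReal.inv_mul_cancel hL0 hL, one_mul, ← mul_assoc,
          ENNReal.inv_mul_cancel hK0 hK, one_mul]
    _ ≤ K⁻¹ * (L⁻¹ * (L * (w ^ p *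
          ∫⁻ z, ‖T (WithLp.toLp r z)‖ₑ ^ p ∂(stableMeasurePi 𝕜 r' σ N)))) := by gcongr
    _ = _ := by rw [← mul_assoc L⁻¹, ENNReal.inv_mul_cancel hL0 hL, one_mul, mul_assoc]

/-- The range of `T` is finite dimensional, so `T = S U` with `U = R T` valued in `ℓ_q^n`. Passing
from `T` to `U` and back costs `(‖S‖ ‖R‖)^p`; taking `ε = 1` gives `lam + 1`. -/
theorem IsStableSummingBound.of_isLgSpaceWith {q : ℝ≥0∞} [Fact (1 ≤ q)] {s : ℝ} {D : ℝ≥0∞}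
    (hp : 0 < p)
    (hD : ∀ n, IsStableSummingBound 𝕜 r s σ p (PiLp q (fun _ : Fin n => 𝕜)) D) {X : Type*}
    [NormedAddCommGroup X] [NormedSpace 𝕜 X] {lam : ℝ} (hX : IsLgSpaceWith 𝕜 q lam X) :
    IsStableSummingBound 𝕜 r s σ p X (ENNReal.ofReal (lam + 1) ^ p * D) := by
  intro N T J x
  obtain ⟨n, R, S, hSR, hle⟩ := hX (LinearMap.range T.toLinearMap) inferInstance 1 one_pos
  set U : PiLp r (fun _ : Fin N => 𝕜) →L[𝕜] PiLp q (fun _ : Fin n => 𝕜) :=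
    R.comp (T.codRestrict _ fun y => LinearMap.mem_range_self T.toLinearMap y) with hU
  have hTU : ∀ y, T y = S (U y) := fun y => (hSR ⟨T y, LinearMap.mem_range_self _ y⟩).symm
  have h1 : ∀ y, ‖T y‖ₑ ^ p ≤ ‖S‖ₑ ^ p * ‖U y‖ₑ ^ p := fun y => by
    rw [hTU, ← ENNReal.mul_rpow_of_nonneg _ _ hp.le]
    exact ENNReal.rpow_le_rpow (S.le_opENorm _) hp.le
  have h2 : ∀ y, ‖U y‖ₑ ^ p ≤ ‖R‖ₑ ^ p * ‖T y‖ₑ ^ p := fun y => by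
    rw [← ENNReal.mul_rpow_of_nonneg _ _ hp.le]
    exact ENNReal.rpow_le_rpow (R.le_opENorm _) hp.le
  have h3 : ‖S‖ₑ ^ p * ‖R‖ₑ ^ p ≤ ENNReal.ofReal (lam + 1) ^ p := by
    rw [← ENNReal.mul_rpow_of_nonneg _ _ hp.le, ← ofReal_norm, ← ofReal_norm,
      ← ENNReal.ofReal_mul (norm_nonneg _)]
    exact ENNReal.rpow_le_rpow (ENNReal.ofReal_le_ofReal hle) hp.le
  have := RCLike.secondCountableTopology 𝕜
  set w := weakSeqNorm 𝕜 p x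
  calc ∑ j, ‖T (x j)‖ₑ ^ p ≤ ‖S‖ₑ ^ p * ∑ j, ‖U (x j)‖ₑ ^ p := by
        rw [Finset.mul_sum]
        exact Finset.sum_le_sum fun j _ => h1 _
    _ ≤ ‖S‖ₑ ^ p * (D * w ^ p *
          ∫⁻ z, ‖R‖ₑ ^ p * ‖T (WithLp.toLp r z)‖ₑ ^ p ∂(stableMeasurePi 𝕜 s σ N)) := by
        gcongr
        refine (hD n N U J x).trans ?_
        gcongr
        exact h2 _
    _ = ‖S‖ₑ ^ p * ‖R‖ₑ ^ p * D * w ^ p *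
          ∫⁻ z, ‖T (WithLp.toLp r z)‖ₑ ^ p ∂(stableMeasurePi 𝕜 s σ N) := by
        rw [lintegral_const_mul _ (by
          have := (continuous_comp_toLp T).enorm.measurable
          fun_prop)]
        ring
    _ ≤ _ := by gcongr

end Linear

theorem ContinuousMultilinearMap.continuous_comp_toLp {𝕜 : Type*} [RCLike 𝕜] {r : ℝ≥0∞}
    {X : Type*} [NormedAddCommGroup X] [NormedSpace 𝕜 X] {m N : ℕ}
    (T : ContinuousMultilinearMap 𝕜 (fun _ : Fin m => PiLp r (fun _ : Fin N => 𝕜)) X) :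
    Continuous fun z : Fin m → Fin N → 𝕜 => T fun k => WithLp.toLp r (z k) :=
  T.cont.comp (continuous_pi fun k => (PiLp.continuous_toLp r _).comp (continuous_apply k))

/-! ### Multilinear operators -/

section Multilinear

variable {𝕜 : Type*} [RCLike 𝕜] {r : ℝ≥0∞} [Fact (1 ≤ r)] {s σ p : ℝ}
  {X : Type*} [NormedAddCommGroup X] [NormedSpace 𝕜 X]

/-- A bound for linear operators passes to multilinear ones, one variable at a time. -/
theorem IsStableSummingBound.sum_multilinear_le (h : 0 < s ∧ s ≤ 2 ∧ 0 < σ) {D : ℝ≥0∞}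
    (hD : IsStableSummingBound 𝕜 r s σ p X D) {N : ℕ} (m : ℕ)
    (T : ContinuousMultilinearMap 𝕜 (fun _ : Fin m => PiLp r (fun _ : Fin N => 𝕜)) X)
    (J : Fin m → ℕ) (x : ∀ k, Fin (J k) → PiLp r (fun _ : Fin N => 𝕜)) :
    ∑ j : ∀ k, Fin (J k), ‖T fun k => x k (j k)‖ₑ ^ p
      ≤ D ^ m * (∏ k, weakSeqNorm 𝕜 p (x k) ^ p) *
        ∫⁻ z : Fin m → Fin N → 𝕜, ‖T fun k => WithLp.toLp r (z k)‖ₑ ^ p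
          ∂(Measure.pi fun _ : Fin m => stableMeasurePi 𝕜 s σ N) := by
  have hP := isProbabilityMeasure_stableMeasurePi 𝕜 h N
  have := RCLike.secondCountableTopology 𝕜
  induction m with
  | zero =>
    have e : ∀ v : Fin 0 → PiLp r (fun _ : Fin N => 𝕜), T v = T 0 := fun v => by
      rw [Subsingleton.elim v 0]
    simp [e]
  | succ m ih =>
    set μ := stableMeasurePi 𝕜 s σ N
    -- Sum and integral are both split into the first variable and the remaining `m`.
    have e1 : ∑ j : ∀ k, Fin (J k), ‖T fun k => x k (j k)‖ₑ ^ p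
        = ∑ b : ∀ k : Fin m, Fin (J k.succ), ∑ a : Fin (J 0),
          ‖T.curryLeft (x 0 a) fun k => x k.succ (b k)‖ₑ ^ p := by
      rw [Finset.sum_comm, ← Fintype.sum_prod_type', ← (Fin.consEquiv fun k => Fin (J k)).sum_comp]
      refine Finset.sum_congr rfl fun ab _ => ?_
      rw [ContinuousMultilinearMap.curryLeft_apply]
      congr 3
      funext k
      refine Fin.cases ?_ (fun k => ?_) k <;> simp [Fin.consEquiv]
    have e2 : ∫⁻ z : Fin (m + 1) → Fin N → 𝕜, ‖T fun k => WithLp.toLp r (z k)‖ₑ ^ p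
          ∂(Measure.pi fun _ : Fin (m + 1) => μ)
        = ∫⁻ y : Fin N → 𝕜, ∫⁻ z : Fin m → Fin N → 𝕜,
          ‖T.curryLeft (WithLp.toLp r y) fun k => WithLp.toLp r (z k)‖ₑ ^ p
          ∂(Measure.pi fun _ : Fin m => μ) ∂μ := by
      have hmp := (measurePreserving_piFinSuccAbove (fun _ : Fin (m + 1) => μ) 0).symm
      have hm : Measurable fun z : Fin (m + 1) → Fin N → 𝕜 =>
          ‖T fun k => WithLp.toLp r (z k)‖ₑ ^ p := by
        have := T.continuous_comp_toLp.enorm.measurable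
        fun_prop
      rw [← hmp.lintegral_comp hm]
      refine (lintegral_prod _ (hm.comp hmp.measurable).aemeasurable).trans ?_
      refine lintegral_congr fun y => lintegral_congr fun z => ?_
      rw [ContinuousMultilinearMap.curryLeft_apply, Function.comp_apply]
      congr 3
      funext k
      refine Fin.cases ?_ (fun k => ?_) k <;> simp [MeasurableEquiv.piFinSuccAbove]
    have hmeas : ∀ v : Fin m → PiLp r (fun _ : Fin N => 𝕜), Measurable fun y : Fin N → 𝕜 =>
        ‖T.curryLeft (WithLp.toLp r y) v‖ₑ ^ p := fun v => by
      have := (_root_.continuous_comp_toLp (𝕜 := 𝕜) ((ContinuousMultilinearMap.apply 𝕜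
        (fun _ : Fin m => PiLp r (fun _ : Fin N => 𝕜)) X v).comp T.curryLeft)).enorm.measurable
      simp only [ContinuousLinearMap.comp_apply, ContinuousMultilinearMap.apply_apply] at this
      fun_prop
    have hmeas2 : Measurable fun y : Fin N → 𝕜 => ∫⁻ z : Fin m → Fin N → 𝕜,
          ‖T.curryLeft (WithLp.toLp r y) fun k => WithLp.toLp r (z k)‖ₑ ^ p
          ∂(Measure.pi fun _ : Fin m => μ) := by
      refine Measurable.lintegral_prod_right' (f := fun v : (Fin N → 𝕜) × (Fin m → Fin N → 𝕜) =>
          ‖T.curryLeft (WithLp.toLp r v.1) fun k => WithLp.toLp r (v.2 k)‖ₑ ^ p) ?_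
      have : Continuous fun v : (Fin N → 𝕜) × (Fin m → Fin N → 𝕜) =>
          T.curryLeft (WithLp.toLp r v.1) fun k => WithLp.toLp r (v.2 k) := by
        simp only [ContinuousMultilinearMap.curryLeft_apply]
        refine T.cont.comp (continuous_pi fun k => ?_)
        refine Fin.cases ?_ (fun k => ?_) k
        · exact (PiLp.continuous_toLp r _).comp continuous_fst
        · exact (PiLp.continuous_toLp r _).comp ((continuous_apply k).comp continuous_snd)
      have := this.enorm.measurable
      fun_prop
    rw [e1, e2, Fin.prod_univ_succ]
    set w := weakSeqNorm 𝕜 p (x 0)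
    -- For fixed `b` the linear bound replaces the sum over `a` by an integral over `y`. For fixed
    -- `y` the induction hypothesis then applies to the `m`-linear map `T.curryLeft y`.
    calc ∑ b : ∀ k : Fin m, Fin (J k.succ), ∑ a : Fin (J 0),
          ‖T.curryLeft (x 0 a) fun k => x k.succ (b k)‖ₑ ^ p
        ≤ ∑ b : ∀ k : Fin m, Fin (J k.succ), D * w ^ p *
          ∫⁻ y, ‖T.curryLeft (WithLp.toLp r y) fun k => x k.succ (b k)‖ₑ ^ p ∂μ :=
          Finset.sum_le_sum fun b _ => hD N ((ContinuousMultilinearMap.apply 𝕜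
            (fun _ : Fin m => PiLp r (fun _ : Fin N => 𝕜)) X fun k => x k.succ (b k)).comp
              T.curryLeft) _ _
      _ = D * w ^ p * ∫⁻ y, ∑ b : ∀ k : Fin m, Fin (J k.succ),
          ‖T.curryLeft (WithLp.toLp r y) fun k => x k.succ (b k)‖ₑ ^ p ∂μ := by
          rw [← Finset.mul_sum, lintegral_finsetSum _ fun b _ => hmeas _]
      _ ≤ D * w ^ p * ∫⁻ y, D ^ m * (∏ k : Fin m, weakSeqNorm 𝕜 p (x k.succ) ^ p) *
          ∫⁻ z : Fin m → Fin N → 𝕜,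
            ‖T.curryLeft (WithLp.toLp r y) fun k => WithLp.toLp r (z k)‖ₑ ^ p
          ∂(Measure.pi fun _ : Fin m => μ) ∂μ := by
          gcongr with y
          exact ih (T.curryLeft (WithLp.toLp r y)) _ _
      _ = _ := by
          rw [lintegral_const_mul _ hmeas2]
          ring

theorem isMultipleSummingBound_iff {𝕜 : Type*} [RCLike 𝕜] {p : ℝ} {X : Type*}
    [NormedAddCommGroup X] [NormedSpace 𝕜 X] {m : ℕ} {E : Fin m → Type*}
    [∀ k, NormedAddCommGroup (E k)] [∀ k, NormedSpace 𝕜 (E k)] (hp : 0 < p)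
    {T : ContinuousMultilinearMap 𝕜 E X} {C : ℝ≥0} :
    IsMultipleSummingBound p T C ↔ ∀ (J : Fin m → ℕ) (x : ∀ k, Fin (J k) → E k),
      ∑ j : ∀ k, Fin (J k), ‖T fun k => x k (j k)‖ₑ ^ p
        ≤ (C : ℝ≥0∞) ^ p * ∏ k, weakSeqNorm 𝕜 p (x k) ^ p := by
  refine forall₂_congr fun J x => ?_
  have e : ∀ a b : ℝ≥0∞, a ^ (1 / p) ≤ b ↔ a ≤ b ^ p := fun a b => by
    rw [one_div, ENNReal.rpow_inv_le_iff hp]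
  rw [e, ENNReal.mul_rpow_of_nonneg _ _ hp.le, ENNReal.prod_rpow_of_nonneg hp.le]

/-! ### Multiple summability from finite dimension, with constants depending on `N` -/

theorem PiLp.enorm_le_sum {N : ℕ} (y : PiLp r (fun _ : Fin N => 𝕜)) : ‖y‖ₑ ≤ ∑ i, ‖y i‖ₑ := by
  set v : Fin N → PiLp r (fun _ : Fin N => 𝕜) := fun i => PiLp.single r i (y i) with hv
  have hy : y = ∑ i, v i := by
    ext j
    simp [hv, Pi.single_apply]
  have h1 : ‖y‖ ≤ ∑ i, ‖y i‖ := by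
    calc ‖y‖ = ‖∑ i, v i‖ := congrArg _ hy
      _ ≤ ∑ i, ‖v i‖ := norm_sum_le _ _
      _ = ∑ i, ‖y i‖ := Finset.sum_congr rfl fun i _ => PiLp.norm_single _ _ _ _
  simp_rw [← ofReal_norm]
  rw [← ENNReal.ofReal_sum_of_nonneg fun _ _ => norm_nonneg _]
  exact ENNReal.ofReal_le_ofReal h1

theorem PiLp.enorm_rpow_le (hp : 0 < p) {N : ℕ} (y : PiLp r (fun _ : Fin N => 𝕜)) :
    ‖y‖ₑ ^ p ≤ (N : ℝ≥0∞) ^ p * ∑ i, ‖y i‖ₑ ^ p := by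
  simpa using (ENNReal.rpow_le_rpow (PiLp.enorm_le_sum y) hp.le).trans
    (ENNReal.sum_rpow_le_card_rpow_mul Finset.univ (fun i => ‖y i‖ₑ) hp)

/-- Coordinate projections have norm at most `1`, so each coordinate contributes at most the weak
norm. The loss in `N` is harmless, since only finiteness is needed. -/
theorem sum_enorm_rpow_le_weakSeqNorm_piLp (hp : 0 < p) {N J : ℕ}
    (x : Fin J → PiLp r (fun _ : Fin N => 𝕜)) :
    ∑ j, ‖x j‖ₑ ^ p ≤ (N : ℝ≥0∞) ^ p * N * weakSeqNorm 𝕜 p x ^ p := by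
  calc ∑ j, ‖x j‖ₑ ^ p ≤ ∑ j, (N : ℝ≥0∞) ^ p * ∑ i, ‖x j i‖ₑ ^ p :=
        Finset.sum_le_sum fun j _ => PiLp.enorm_rpow_le hp _
    _ = (N : ℝ≥0∞) ^ p * ∑ i : Fin N, ∑ j, ‖x j i‖ₑ ^ p := by
        rw [← Finset.mul_sum, Finset.sum_comm]
    _ ≤ (N : ℝ≥0∞) ^ p * ∑ i : Fin N, weakSeqNorm 𝕜 p x ^ p := by
        gcongr with i
        refine (sum_enorm_rpow_le_weakSeqNorm hp x
          (PiLp.proj r (fun _ : Fin N => 𝕜) i)).trans (mul_le_of_le_one_left (by simp) ?_)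
        refine ENNReal.rpow_le_one ?_ hp.le
        rw [← ofReal_norm, ENNReal.ofReal_le_one]
        refine ContinuousLinearMap.opNorm_le_bound _ zero_le_one fun y => ?_
        simpa using PiLp.norm_apply_le y i
    _ = _ := by simp [mul_assoc]

theorem isMultipleSumming_piLp (hp : 0 < p) {m N : ℕ}
    (T : ContinuousMultilinearMap 𝕜 (fun _ : Fin m => PiLp r (fun _ : Fin N => 𝕜)) X) :
    IsMultipleSumming p T := by
  set A : ℝ≥0∞ := ‖T‖ₑ ^ p * ((N : ℝ≥0∞) ^ p * N) ^ m with hA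
  have hA' : A ≠ ∞ := by
    have h1 : (N : ℝ≥0∞) ^ p ≠ ∞ := ENNReal.rpow_ne_top_of_nonneg hp.le (by simp)
    exact ENNReal.mul_ne_top (ENNReal.rpow_ne_top_of_nonneg hp.le enorm_ne_top)
      (ENNReal.pow_ne_top (ENNReal.mul_ne_top h1 (by simp)))
  have hA'' : A ^ (1 / p) ≠ ∞ := ENNReal.rpow_ne_top_of_nonneg (by positivity) hA'
  -- Admissible constants must be positive, and `A` may vanish; hence the `+ 1`.
  refine ⟨(A ^ (1 / p)).toNNReal + 1, by positivity, (isMultipleSummingBound_iff hp).2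
    fun J x => ?_⟩
  have hC : A ≤ (((A ^ (1 / p)).toNNReal + 1 : ℝ≥0) : ℝ≥0∞) ^ p := by
    rw [ENNReal.coe_add, ENNReal.coe_toNNReal hA'']
    calc A = (A ^ (1 / p)) ^ p := by
          rw [← ENNReal.rpow_mul, one_div_mul_cancel hp.ne', ENNReal.rpow_one]
      _ ≤ _ := ENNReal.rpow_le_rpow le_self_add hp.le
  refine le_trans ?_ (mul_le_mul_left hC _)
  calc ∑ j : ∀ k, Fin (J k), ‖T fun k => x k (j k)‖ₑ ^ p
      ≤ ∑ j : ∀ k, Fin (J k), ‖T‖ₑ ^ p * ∏ k, ‖x k (j k)‖ₑ ^ p := by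
        refine Finset.sum_le_sum fun j _ => ?_
        rw [ENNReal.prod_rpow_of_nonneg hp.le, ← ENNReal.mul_rpow_of_nonneg _ _ hp.le]
        refine ENNReal.rpow_le_rpow ?_ hp.le
        have := T.le_opNorm fun k => x k (j k)
        simp_rw [← ofReal_norm]
        rw [← ENNReal.ofReal_prod_of_nonneg fun _ _ => norm_nonneg _,
          ← ENNReal.ofReal_mul (norm_nonneg _)]
        exact ENNReal.ofReal_le_ofReal this
    _ = ‖T‖ₑ ^ p * ∏ k, ∑ j, ‖x k j‖ₑ ^ p := by
        rw [← Finset.mul_sum, Finset.prod_univ_sum, Fintype.piFinset_univ]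
    _ ≤ ‖T‖ₑ ^ p * ∏ k, ((N : ℝ≥0∞) ^ p * N * weakSeqNorm 𝕜 p (x k) ^ p) := by
        gcongr with k
        exact sum_enorm_rpow_le_weakSeqNorm_piLp hp (x k)
    _ = _ := by
        rw [Finset.prod_mul_distrib, Finset.prod_const, Finset.card_univ, Fintype.card_fin, hA,
          mul_assoc]

end Multilinear

/-! ### Lower estimate, for arbitrary target spaces -/

section Lower

variable {𝕜 : Type*} [RCLike 𝕜] {p : ℝ}

theorem lintegral_comp_of_fintype {Ω ι : Type*} [MeasurableSpace Ω] [Fintype ι] [MeasurableSpace ι]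
    [MeasurableSingletonClass ι] (μ : Measure Ω) {f : Ω → ι} (hf : Measurable f) (G : ι → ℝ≥0∞) :
    ∫⁻ z, G (f z) ∂μ = ∑ i, G i * μ (f ⁻¹' {i}) := by
  rw [← lintegral_map (Measurable.of_discrete) hf, lintegral_fintype]
  exact Finset.sum_congr rfl fun i _ => by rw [Measure.map_apply hf (measurableSet_singleton i)]

/-- Multiple summing inequalities apply to weighted values of a simple function. -/
theorem IsMultipleSummingBound.lintegral_simpleFunc_le {E X Ω : Type*} [NormedAddCommGroup E]
    [NormedSpace 𝕜 E] [NormedAddCommGroup X] [NormedSpace 𝕜 X] [MeasurableSpace Ω] (μ : Measure Ω)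
    [IsProbabilityMeasure μ] {m : ℕ} (hp : 0 < p)
    {T : ContinuousMultilinearMap 𝕜 (fun _ : Fin m => E) X} {C : ℝ≥0}
    (hC : IsMultipleSummingBound p T C) (f : SimpleFunc Ω E) {B : ℝ≥0∞}
    (hB : ∀ γ : StrongDual 𝕜 E, ‖γ‖ ≤ 1 → ∫⁻ z, ‖γ (f z)‖ₑ ^ p ∂μ ≤ B) :
    ∫⁻ z : Fin m → Ω, ‖T fun k => f (z k)‖ₑ ^ p ∂(Measure.pi fun _ => μ)
      ≤ (C : ℝ≥0∞) ^ p * B ^ m := by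
  set e := f.range.equivFin
  set idx : Ω → Fin f.range.card := fun z => e ⟨f z, f.mem_range_self z⟩ with hidx
  set v : Fin f.range.card → E := fun j => (e.symm j : E)
  have hv : ∀ z, f z = v (idx z) := fun z => by simp [v, idx]
  have hidxm : Measurable idx := measurable_to_countable' fun j => by
    have : idx ⁻¹' {j} = f ⁻¹' {v j} := by
      ext z
      simp only [Set.mem_preimage, Set.mem_singleton_iff, hidx, v]
      rw [← Equiv.eq_symm_apply, Subtype.ext_iff]
    rw [this]
    exact f.measurableSet_fiber _
  -- With weights `μ(f = v_j)^{1/p}`, `p`-th power sums of the vectors `c_j v_j` become integrals of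
  -- `f`, both for functionals and, by multilinearity and the product measure, for `T`.
  set c : Fin f.range.card → 𝕜 := fun j => ((μ.real (idx ⁻¹' {j}) ^ (1 / p) : ℝ) : 𝕜) with hc
  have hcp : ∀ j, ‖c j‖ₑ ^ p = μ (idx ⁻¹' {j}) := fun j => by
    rw [hc, ← ofReal_norm, RCLike.norm_ofReal, abs_of_nonneg (by positivity),
      ENNReal.ofReal_rpow_of_nonneg (by positivity) hp.le, ← Real.rpow_mul (by positivity),
      one_div_mul_cancel hp.ne', Real.rpow_one, ofReal_measureReal]
  have hw : weakSeqNorm 𝕜 p (fun j => c j • v j) ^ p ≤ B := by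
    have : weakSeqNorm 𝕜 p (fun j => c j • v j) ≤ B ^ (1 / p) := by
      refine iSup₂_le fun γ hγ => ENNReal.rpow_le_rpow ?_ (by positivity)
      refine le_trans (le_of_eq ?_) (hB γ hγ)
      simp_rw [hv]
      rw [lintegral_comp_of_fintype μ hidxm fun j => ‖γ (v j)‖ₑ ^ p]
      refine Finset.sum_congr rfl fun j _ => ?_
      rw [map_smul, enorm_smul, ENNReal.mul_rpow_of_nonneg _ _ hp.le, hcp, mul_comm]
    refine (ENNReal.rpow_le_rpow this hp.le).trans (le_of_eq ?_)
    rw [← ENNReal.rpow_mul, one_div_mul_cancel hp.ne', ENNReal.rpow_one]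
  have hT := (isMultipleSummingBound_iff hp).1 hC (fun _ => f.range.card) fun _ j => c j • v j
  have hidxm' : Measurable fun (z : Fin m → Ω) k => idx (z k) :=
    measurable_pi_lambda _ fun k => hidxm.comp (measurable_pi_apply k)
  simp_rw [hv]
  rw [lintegral_comp_of_fintype _ hidxm' fun j => ‖T fun k => v (j k)‖ₑ ^ p]
  calc ∑ j : Fin m → Fin f.range.card, ‖T fun k => v (j k)‖ₑ ^ p *
        (Measure.pi fun _ => μ) ((fun (z : Fin m → Ω) k => idx (z k)) ⁻¹' {j})
      = ∑ j : Fin m → Fin f.range.card, ‖T fun k => c (j k) • v (j k)‖ₑ ^ p := by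
        refine Finset.sum_congr rfl fun j _ => ?_
        have : (fun (z : Fin m → Ω) k => idx (z k)) ⁻¹' {j}
            = Set.pi Set.univ fun k => idx ⁻¹' {j k} := by
          ext z; simp [funext_iff]
        rw [this, Measure.pi_pi, T.map_smul_univ (fun k => c (j k)) fun k => v (j k), enorm_smul,
          ENNReal.mul_rpow_of_nonneg _ _ hp.le, mul_comm]
        congr 1
        simp_rw [← hcp]
        rw [ENNReal.prod_rpow_of_nonneg hp.le]
        congr 1
        simp only [← ofReal_norm, norm_prod]
        rw [ENNReal.ofReal_prod_of_nonneg fun _ _ => norm_nonneg _]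
    _ ≤ (C : ℝ≥0∞) ^ p * ∏ k : Fin m, weakSeqNorm 𝕜 p (fun j => c j • v j) ^ p := hT
    _ ≤ (C : ℝ≥0∞) ^ p * B ^ m := by
        rw [Finset.prod_const, Finset.card_univ, Fintype.card_fin]
        gcongr

variable {r : ℝ≥0∞} [Fact (1 ≤ r)] {r' σ : ℝ} {X : Type*} [NormedAddCommGroup X] [NormedSpace 𝕜 X]

theorem lintegral_enorm_toLp_lt_top {s : ℝ} (h : 0 < s ∧ s ≤ 2 ∧ 0 < σ) (hp : 0 < p)
    (hps : p < s ∨ s = 2) (N : ℕ) :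
    ∫⁻ z : Fin N → 𝕜, ‖WithLp.toLp r z‖ₑ ^ p ∂(stableMeasurePi 𝕜 s σ N) < ∞ := by
  have hP := (stableMeasure_spec 𝕜 h).1
  refine (lintegral_mono fun z => PiLp.enorm_rpow_le hp (WithLp.toLp r z)).trans_lt ?_
  rw [lintegral_const_mul _ (by fun_prop), lintegral_finsetSum _ fun i _ => by fun_prop]
  refine ENNReal.mul_lt_top (ENNReal.rpow_lt_top_of_nonneg hp.le (by simp))
    (ENNReal.sum_lt_top.2 fun i _ => ?_)
  have hmp := measurePreserving_eval (fun _ : Fin N => stableMeasure 𝕜 s σ) i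
  have := hmp.lintegral_comp (f := fun y : 𝕜 => ‖y‖ₑ ^ p) (by fun_prop)
  rw [stableMeasurePi]
  exact this.trans_lt (stableMoment_ne_top 𝕜 h hp hps).lt_top

/-- Simple functions `f n` converge to the identity in `L_p`, so eventually their weak `p`-th
moments are at most `2^p (K + K)`, the second `K` absorbing the approximation error. The inequality
for simple functions survives the limit by Fatou's lemma. -/
theorem IsMultipleSummingBound.lintegral_stable_le (hr : r.HolderConjugate (ENNReal.ofReal r'))
    (hr2 : r' ≤ 2) (hσ : 0 < σ) (hp : 0 < p) (hpr : p < r' ∨ r' = 2) {m N : ℕ}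
    {T : ContinuousMultilinearMap 𝕜 (fun _ : Fin m => PiLp r (fun _ : Fin N => 𝕜)) X} {C : ℝ≥0}
    (hC : IsMultipleSummingBound p T C) :
    ∫⁻ z : Fin m → Fin N → 𝕜, ‖T fun k => WithLp.toLp r (z k)‖ₑ ^ p
        ∂(Measure.pi fun _ : Fin m => stableMeasurePi 𝕜 r' σ N)
      ≤ (C : ℝ≥0∞) ^ p *
        (2 ^ p * (stableMoment 𝕜 r' σ p + stableMoment 𝕜 r' σ p)) ^ m := by
  have h1r : 1 ≤ ENNReal.ofReal r' := hr.symm.one_le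
  have hr0 : 0 < r' := ENNReal.ofReal_pos.1 (zero_lt_one.trans_le h1r)
  have hP := isProbabilityMeasure_stableMeasurePi 𝕜 ⟨hr0, hr2, hσ⟩ N
  have := RCLike.secondCountableTopology 𝕜
  set μ := stableMeasurePi 𝕜 r' σ N
  set K := stableMoment 𝕜 r' σ p
  have hK0 : K ≠ 0 := stableMoment_ne_zero 𝕜 ⟨hr0, hr2, hσ⟩ hp
  have hL : Measurable fun z : Fin N → 𝕜 => WithLp.toLp r z := (PiLp.continuous_toLp r _).measurable
  set f : ℕ → SimpleFunc (Fin N → 𝕜) (PiLp r (fun _ : Fin N => 𝕜)) :=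
    SimpleFunc.approxOn (fun z : Fin N → 𝕜 => WithLp.toLp r z) hL Set.univ 0 (Set.mem_univ _)
    with hf
  have hlim : ∀ z, Filter.Tendsto (fun n => f n z) Filter.atTop (nhds (WithLp.toLp r z)) :=
    fun z => SimpleFunc.tendsto_approxOn hL (Set.mem_univ _) (by simp)
  -- Approximation based at `0` gives `‖f n z‖ ≤ 2 ‖z‖`, hence the factor `3` in the dominating
  -- function.
  have hbd : ∀ n z, ‖f n z - WithLp.toLp r z‖ₑ ≤ 3 * ‖WithLp.toLp r z‖ₑ := fun n z => by
    have h1 := SimpleFunc.edist_approxOn_y0_le hL (Set.mem_univ (0 : PiLp r (fun _ : Fin N => 𝕜))) z n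
    rw [edist_comm, edist_zero_right, edist_comm, edist_zero_right] at h1
    calc ‖f n z - WithLp.toLp r z‖ₑ ≤ ‖f n z‖ₑ + ‖WithLp.toLp r z‖ₑ := enorm_sub_le
      _ ≤ (‖WithLp.toLp r z‖ₑ + ‖WithLp.toLp r z‖ₑ) + ‖WithLp.toLp r z‖ₑ := by gcongr
      _ = 3 * ‖WithLp.toLp r z‖ₑ := by ring
  have hint := lintegral_enorm_toLp_lt_top (𝕜 := 𝕜) (r := r) ⟨hr0, hr2, hσ⟩ hp hpr N
  have hε : Filter.Tendsto (fun n => ∫⁻ z, ‖f n z - WithLp.toLp r z‖ₑ ^ p ∂μ) Filter.atTop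
      (nhds 0) := by
    have hzero : ∫⁻ _ : Fin N → 𝕜, (0 : ℝ≥0∞) ∂μ = 0 := lintegral_zero
    rw [← hzero]
    refine tendsto_lintegral_of_dominated_convergence
      (fun z => 3 ^ p * ‖WithLp.toLp r z‖ₑ ^ p) (fun n => ?_) (fun n => ?_) ?_ ?_
    · exact (((f n).measurable.sub hL).enorm).pow_const p
    · refine Filter.Eventually.of_forall fun z => ?_
      exact (ENNReal.rpow_le_rpow (hbd n z) hp.le).trans_eq (ENNReal.mul_rpow_of_nonneg _ _ hp.le)
    · rw [lintegral_const_mul _ (hL.enorm.pow_const p)]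
      exact ENNReal.mul_ne_top (ENNReal.rpow_ne_top_of_nonneg hp.le (by simp)) hint.ne
    · refine Filter.Eventually.of_forall fun z => ?_
      have h1 : Filter.Tendsto (fun n => ‖f n z - WithLp.toLp r z‖ₑ ^ p) Filter.atTop
          (nhds (‖WithLp.toLp r z - WithLp.toLp r z‖ₑ ^ p)) :=
        ((ENNReal.continuous_rpow_const.tendsto _).comp
          ((continuous_enorm.tendsto _).comp ((hlim z).sub_const _)))
      simpa [hp] using h1
  have hev : ∀ᶠ n in Filter.atTop,
      ∫⁻ z : Fin m → Fin N → 𝕜, ‖T fun k => f n (z k)‖ₑ ^ p ∂(Measure.pi fun _ : Fin m => μ)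
        ≤ (C : ℝ≥0∞) ^ p * (2 ^ p * (K + K)) ^ m := by
    -- The threshold `K` is allowed because the moment is positive.
    filter_upwards [hε.eventually (gt_mem_nhds (pos_iff_ne_zero.2 hK0))] with n hn
    refine hC.lintegral_simpleFunc_le μ hp (f n) fun γ hγ => ?_
    have hγ' : ‖γ‖ₑ ≤ 1 := by rwa [← ofReal_norm, ENNReal.ofReal_le_one]
    have hγ1 : ∀ y, ‖γ y‖ₑ ≤ ‖y‖ₑ := fun y =>
      (γ.le_opENorm y).trans (mul_le_of_le_one_left (by simp) hγ')
    calc ∫⁻ z, ‖γ (f n z)‖ₑ ^ p ∂μ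
        ≤ ∫⁻ z, 2 ^ p * (‖γ (WithLp.toLp r z)‖ₑ ^ p + ‖f n z - WithLp.toLp r z‖ₑ ^ p) ∂μ := by
          refine lintegral_mono fun z => ?_
          refine le_trans (ENNReal.rpow_le_rpow ?_ hp.le) (ENNReal.add_rpow_le_two_rpow_mul hp _ _)
          calc ‖γ (f n z)‖ₑ = ‖γ (WithLp.toLp r z) + γ (f n z - WithLp.toLp r z)‖ₑ := by
                rw [← map_add, add_sub_cancel]
            _ ≤ ‖γ (WithLp.toLp r z)‖ₑ + ‖γ (f n z - WithLp.toLp r z)‖ₑ := enorm_add_le _ _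
            _ ≤ _ := by gcongr; exact hγ1 _
      _ = 2 ^ p * (‖γ‖ₑ ^ p * K + ∫⁻ z, ‖f n z - WithLp.toLp r z‖ₑ ^ p ∂μ) := by
          have hm1 : Measurable fun z : Fin N → 𝕜 => ‖γ (WithLp.toLp r z)‖ₑ ^ p :=
            (continuous_comp_toLp γ).enorm.measurable.pow_const p
          have hm2 : Measurable fun z : Fin N → 𝕜 => ‖f n z - WithLp.toLp r z‖ₑ ^ p :=
            (((f n).measurable.sub hL).enorm).pow_const p
          rw [lintegral_const_mul _ (by fun_prop), lintegral_add_left hm1,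
            lintegral_dual_piLp hr hr2 hσ hp]
      _ ≤ 2 ^ p * (K + K) := by
          gcongr
          exact mul_le_of_le_one_left (by simp) (ENNReal.rpow_le_one hγ' hp.le)
  calc ∫⁻ z : Fin m → Fin N → 𝕜, ‖T fun k => WithLp.toLp r (z k)‖ₑ ^ p
        ∂(Measure.pi fun _ : Fin m => μ)
      = ∫⁻ z : Fin m → Fin N → 𝕜, Filter.liminf (fun n => ‖T fun k => f n (z k)‖ₑ ^ p) Filter.atTop
        ∂(Measure.pi fun _ : Fin m => μ) := by
        refine lintegral_congr fun z => (Filter.Tendsto.liminf_eq ?_).symm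
        exact (ENNReal.continuous_rpow_const.tendsto _).comp ((continuous_enorm.tendsto _).comp
          ((T.cont.tendsto _).comp (tendsto_pi_nhds.2 fun k => hlim (z k))))
    _ ≤ Filter.liminf (fun n => ∫⁻ z : Fin m → Fin N → 𝕜, ‖T fun k => f n (z k)‖ₑ ^ p
        ∂(Measure.pi fun _ : Fin m => μ)) Filter.atTop := by
        refine lintegral_liminf_le fun n => ?_
        have h1 : Measurable fun v : Fin m → PiLp r (fun _ : Fin N => 𝕜) => ‖T v‖ₑ ^ p :=
          T.cont.enorm.measurable.pow_const p
        exact h1.comp (measurable_pi_lambda _ fun k => (f n).measurable.comp (measurable_pi_apply k))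
    _ ≤ _ := Filter.liminf_le_of_frequently_le' hev.frequently

theorem exists_mul_stableIntegralNorm_le (𝕜 : Type*) [RCLike 𝕜]
    (hr : r.HolderConjugate (ENNReal.ofReal r')) (hr2 : r' ≤ 2)
    (hσ : 0 < σ) (hp : 0 < p) (hpr : p < r' ∨ r' = 2) (m : ℕ) :
    ∃ c : ℝ≥0, 0 < c ∧ ∀ (X : Type*) [NormedAddCommGroup X] [NormedSpace 𝕜 X] (N : ℕ)
      (T : ContinuousMultilinearMap 𝕜 (fun _ : Fin m => PiLp r (fun _ : Fin N => 𝕜)) X),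
      c * stableIntegralNorm r' σ p T ≤ multipleSummingNorm p T := by
  have h1r : 1 ≤ ENNReal.ofReal r' := hr.symm.one_le
  have hr0 : 0 < r' := ENNReal.ofReal_pos.1 (zero_lt_one.trans_le h1r)
  have hK0 := stableMoment_ne_zero 𝕜 ⟨hr0, hr2, hσ⟩ hp
  have hK := stableMoment_ne_top 𝕜 ⟨hr0, hr2, hσ⟩ hp hpr
  -- `A` involves only `m`, `p` and the moment of the scalar stable law, so `c = A⁻¹` does not
  -- depend on `N`, `T` or `X`.
  set A : ℝ≥0∞ := ((2 ^ p * (stableMoment 𝕜 r' σ p + stableMoment 𝕜 r' σ p)) ^ m) ^ (1 / p) with hA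
  have h2 : (2 ^ p * (stableMoment 𝕜 r' σ p + stableMoment 𝕜 r' σ p)) ^ m ≠ ∞ :=
    ENNReal.pow_ne_top (ENNReal.mul_ne_top (ENNReal.rpow_ne_top_of_nonneg hp.le (by simp))
      (ENNReal.add_ne_top.2 ⟨hK, hK⟩))
  have h3 : (2 ^ p * (stableMoment 𝕜 r' σ p + stableMoment 𝕜 r' σ p)) ^ m ≠ 0 := by
    refine pow_ne_zero _ (mul_ne_zero ?_ (by simp [hK0]))
    exact (ENNReal.rpow_pos (by simp) (by simp)).ne'
  have hAt : A ≠ ∞ := ENNReal.rpow_ne_top_of_nonneg (by positivity) h2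
  have hA0 : A ≠ 0 := (ENNReal.rpow_pos (pos_iff_ne_zero.2 h3) h2).ne'
  refine ⟨A⁻¹.toNNReal, ENNReal.toNNReal_pos (by simp [hAt]) (by simp [hA0]), fun X _ _ N T => ?_⟩
  rw [ENNReal.coe_toNNReal (by simp [hA0])]
  refine le_iInf₂ fun C hC => ?_
  have h4 := ENNReal.rpow_le_rpow (hC.2.lintegral_stable_le hr hr2 hσ hp hpr)
    (one_div_nonneg.2 hp.le)
  rw [ENNReal.mul_rpow_of_nonneg _ _ (by positivity), ← ENNReal.rpow_mul,
    mul_one_div_cancel hp.ne', ENNReal.rpow_one] at h4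
  calc A⁻¹ * stableIntegralNorm r' σ p T ≤ A⁻¹ * (C * A) := by gcongr; exact h4
    _ = C := by rw [mul_left_comm, ENNReal.inv_mul_cancel hA0 hAt, mul_one]

end Lower

/-! ### Assembly of the two estimates -/

theorem IsStableSummingBound.multipleSummingNorm_le {𝕜 : Type*} [RCLike 𝕜] {r : ℝ≥0∞}
    [Fact (1 ≤ r)] {s σ p : ℝ} {X : Type*} [NormedAddCommGroup X] [NormedSpace 𝕜 X]
    (h : 0 < s ∧ s ≤ 2 ∧ 0 < σ) (hp : 0 < p) {D : ℝ≥0∞} (hD : IsStableSummingBound 𝕜 r s σ p X D)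
    {m N : ℕ} (T : ContinuousMultilinearMap 𝕜 (fun _ : Fin m => PiLp r (fun _ : Fin N => 𝕜)) X) :
    multipleSummingNorm p T ≤ (D ^ m) ^ (1 / p) * stableIntegralNorm s σ p T := by
  -- The bound `a` may be `0` while admissible constants are positive, so `a + ε` is used instead.
  refine ENNReal.le_of_forall_pos_le_add fun ε hε hfin => ?_
  set I := stableIntegralNorm s σ p T with hI
  set a := (D ^ m) ^ (1 / p) * I with ha
  have hC : ((a.toNNReal + ε : ℝ≥0) : ℝ≥0∞) = a + ε := by
    rw [ENNReal.coe_add, ENNReal.coe_toNNReal hfin.ne]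
  rw [← hC]
  refine iInf₂_le _ ⟨by positivity, (isMultipleSummingBound_iff hp).2 fun J x => ?_⟩
  refine (hD.sum_multilinear_le h m T J x).trans ?_
  rw [mul_right_comm]
  refine mul_le_mul_left ?_ _
  calc _ = a ^ p := by
        rw [ha, ENNReal.mul_rpow_of_nonneg _ _ hp.le, ← ENNReal.rpow_mul,
          one_div_mul_cancel hp.ne', ENNReal.rpow_one, hI, stableIntegralNorm, ← ENNReal.rpow_mul,
          one_div_mul_cancel hp.ne', ENNReal.rpow_one]
    _ ≤ _ := by
        rw [hC]
        exact ENNReal.rpow_le_rpow le_self_add hp.le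

theorem exists_isStableSummingBound {𝕜 : Type*} [RCLike 𝕜] {r : ℝ≥0∞} [Fact (1 ≤ r)]
    {r' σ p : ℝ} (hr : r.HolderConjugate (ENNReal.ofReal r')) (hr2 : r' ≤ 2) (hσ : 0 < σ)
    (hp : 0 < p) (hpr : p < r' ∨ r' = 2) {q : ℝ≥0∞} [Fact (1 ≤ q)] (hq : q ≠ ∞)
    (hpq : q.toReal ≤ p ∨ q.toReal ≤ 2) {X : Type*} [NormedAddCommGroup X] [NormedSpace 𝕜 X]
    (hX : IsLgSpace 𝕜 q X) :
    ∃ D : ℝ≥0∞, D ≠ 0 ∧ D ≠ ∞ ∧ IsStableSummingBound 𝕜 r r' σ p X D := by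
  have h1r : 1 ≤ ENNReal.ofReal r' := hr.symm.one_le
  have hr0 : 0 < r' := ENNReal.ofReal_pos.1 (zero_lt_one.trans_le h1r)
  have hq0 : 0 < q.toReal := ENNReal.toReal_pos (zero_lt_one.trans_le Fact.out).ne' hq
  obtain ⟨lam, hlam, hX⟩ := hX
  obtain ⟨D, hD0, hDt, hD⟩ : ∃ D : ℝ≥0∞, D ≠ 0 ∧ D ≠ ∞ ∧ ∀ n,
      IsStableSummingBound 𝕜 r r' σ p (PiLp q (fun _ : Fin n => 𝕜)) D := by
    -- `q ≤ p` is the Minkowski case; otherwise `p < q ≤ 2` and the `q`-stable embedding applies.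
    -- Neither constant depends on `n`.
    rcases le_or_gt q.toReal p with hle | hlt
    · have hK0 := stableMoment_ne_zero 𝕜 ⟨hr0, hr2, hσ⟩ hq0
      have hK := stableMoment_ne_top 𝕜 ⟨hr0, hr2, hσ⟩ hq0 (hpr.imp_left hle.trans_lt)
      refine ⟨_, (ENNReal.rpow_pos (by simpa [pos_iff_ne_zero] using hK) (by simpa using hK0)).ne',
        ENNReal.rpow_ne_top_of_nonneg (by positivity) (by simpa using hK0),
        isStableSummingBound_piLp_of_le hr hr2 hσ hpr hq hle⟩
    · exact ⟨_, by simpa using stableMoment_ne_top 𝕜 ⟨hr0, hr2, hσ⟩ hp hpr,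
        by simpa using stableMoment_ne_zero 𝕜 ⟨hr0, hr2, hσ⟩ hp,
        isStableSummingBound_piLp_of_lt hr hr2 hσ hp hpr hlt (hpq.resolve_left hlt.not_ge) hq⟩
  have hl0 : ENNReal.ofReal (lam + 1) ≠ 0 := (ENNReal.ofReal_pos.2 (by linarith)).ne'
  exact ⟨_, mul_ne_zero (ENNReal.rpow_pos (pos_iff_ne_zero.2 hl0) ENNReal.ofReal_ne_top).ne' hD0,
    ENNReal.mul_ne_top (ENNReal.rpow_ne_top_of_nonneg hp.le ENNReal.ofReal_ne_top) hDt,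
    IsStableSummingBound.of_isLgSpaceWith hp hD hX⟩

theorem proposition1p3 {𝕜 : Type*} [RCLike 𝕜] (m : ℕ) (p : ℝ) (hp : 0 < p)
    (r : ℝ≥0∞) [Fact (1 ≤ r)] (r' : ℝ) (hr : r.HolderConjugate (ENNReal.ofReal r'))
    (σ : ℝ) (hσ : 0 < σ) :
    (∀ (q : ℝ≥0∞) [Fact (1 ≤ q)] (X : Type*) [NormedAddCommGroup X] [NormedSpace 𝕜 X],
      IsLgSpace 𝕜 q X →
      ((r = 2 ∧ p < 2 ∧ q < 2) ∨ (r = 2 ∧ q ≤ ENNReal.ofReal p) ∨ (p < r' ∧ r' < 2 ∧ q ≤ 2)) →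
      ∃ c C : ℝ≥0, 0 < c ∧ 0 < C ∧ ∀ (N : ℕ)
        (T : ContinuousMultilinearMap 𝕜 (fun _ : Fin m => PiLp r (fun _ : Fin N => 𝕜)) X),
        IsMultipleSumming p T ∧
        c * stableIntegralNorm r' σ p T ≤ multipleSummingNorm p T ∧
        multipleSummingNorm p T ≤ C * stableIntegralNorm r' σ p T) ∧
    ((r = 2 ∨ (p < r' ∧ r' < 2)) →
      ∃ c : ℝ≥0, 0 < c ∧
        ∀ (X : Type*) [NormedAddCommGroup X] [NormedSpace 𝕜 X] [CompleteSpace X] (N : ℕ)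
        (T : ContinuousMultilinearMap 𝕜 (fun _ : Fin m => PiLp r (fun _ : Fin N => 𝕜)) X),
        IsMultipleSumming p T ∧
        c * stableIntegralNorm r' σ p T ≤ multipleSummingNorm p T) := by

  have hr0 : 0 < r' := ENNReal.ofReal_pos.1 (zero_lt_one.trans_le hr.symm.one_le)
  have hr'2 : r = 2 → r' = 2 := by
    rintro rfl
    have : ENNReal.ofReal r' = 2 := ENNReal.HolderConjugate.unique 2 (ENNReal.ofReal r') 2
    simpa [ENNReal.toReal_ofReal hr0.le] using congrArg ENNReal.toReal this
  -- All the cases meet in one condition: `r'` is a stability index and the `p`-th moment of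
  -- `μ_{r'}` is finite.
  have hpar : (r = 2 ∨ (p < r' ∧ r' < 2)) → r' ≤ 2 ∧ (p < r' ∨ r' = 2) := by
    rintro (h | h)
    · exact ⟨(hr'2 h).le, Or.inr (hr'2 h)⟩
    · exact ⟨h.2.le, Or.inl h.1⟩
  refine ⟨fun q _ X _ _ hX hcase => ?_, fun hcase => ?_⟩
  · obtain ⟨hr2, hpr⟩ := hpar (by tauto)
    -- Likewise every case gives a finite `q` with `q ≤ p` or `q ≤ 2`.
    have hq : q ≠ ∞ ∧ (q.toReal ≤ p ∨ q.toReal ≤ 2) := by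
      have two : ∀ {a : ℝ≥0∞}, a ≤ 2 → a ≠ ∞ ∧ (a.toReal ≤ p ∨ a.toReal ≤ 2) := fun ha =>
        ⟨(ha.trans_lt (by simp)).ne, Or.inr (by simpa using ENNReal.toReal_mono (by simp) ha)⟩
      rcases hcase with ⟨-, -, h⟩ | ⟨-, h⟩ | ⟨-, -, h⟩
      · exact two h.le
      · exact ⟨(h.trans_lt ENNReal.ofReal_lt_top).ne, Or.inl (ENNReal.toReal_le_of_le_ofReal hp.le h)⟩
      · exact two h
    obtain ⟨c, hc, hlow⟩ := exists_mul_stableIntegralNorm_le 𝕜 hr hr2 hσ hp hpr m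
    obtain ⟨D, hD0, hDt, hD⟩ := exists_isStableSummingBound hr hr2 hσ hp hpr hq.1 hq.2 hX
    have hDm : D ^ m ≠ ∞ := ENNReal.pow_ne_top hDt
    have hCt : (D ^ m) ^ (1 / p) ≠ ∞ := ENNReal.rpow_ne_top_of_nonneg (by positivity) hDm
    have hC0 : (D ^ m) ^ (1 / p) ≠ 0 :=
      (ENNReal.rpow_pos (pos_iff_ne_zero.2 (pow_ne_zero m hD0)) hDm).ne'
    refine ⟨c, ((D ^ m) ^ (1 / p)).toNNReal, hc, ENNReal.toNNReal_pos hC0 hCt, fun N T =>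
      ⟨isMultipleSumming_piLp hp T, hlow X N T, ?_⟩⟩
    rw [ENNReal.coe_toNNReal hCt]
    exact hD.multipleSummingNorm_le ⟨hr0, hr2, hσ⟩ hp T
  · obtain ⟨hr2, hpr⟩ := hpar hcase
    obtain ⟨c, hc, hlow⟩ := exists_mul_stableIntegralNorm_le 𝕜 hr hr2 hσ hp hpr m
    exact ⟨c, hc, fun X _ _ _ N T => ⟨isMultipleSumming_piLp hp T, hlow X N T⟩⟩
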